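/- Let $R$ be a ring with unit, not necessarily commutative. All modules are right modules. Let $R[x,x^{-1}]$ be the Laurent polynomial ring in a central variable $x$, and let $R((x))=R[[x]][1/x]$ and $R((x^{-1}))=R[[x^{-1}]][1/x^{-1}]$ be the rings of formal Laurent series in $x$ and in $x^{-1}$, both containing $R[x,x^{-1}]$. Call a chain complex of $R$-modules strict perfect if it is bounded and consists of finitely generated projective $R$-modules; $R$-perfect if it is connected by a finite chain of quasi-isomorphisms to a strict perfect complex; and $R$-finitely dominated if it is chain homotopy equivalent to a strict perfect complex. Theorem. Let $C$ be a bounded ($\mathbb{Z}$-indexed) chain complex of finitely generated free $R[x,x^{-1}]$-modules. If both complexes $$C\otimes_{R[x,x^{-1}]}R((x))\qquad\text{and}\qquad C\otimes_{R[x,x^{-1}]}R((x^{-1}))$$ are acyclic, then $C$, regarded as a complex of $R$-modules by restriction of scalars along $R\subset R[x,x^{-1}]$, is $R$-perfect, and also $R$-finitely dominated. -/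

import Mathlib

open CategoryTheory
open scoped TensorProduct LaurentPolynomial LaurentSeries

universe u

noncomputable section

namespace Novikov

/-! ### Extension of scalars over noncommutative rings -/

section ExtendScalars

variable {A B : Type u} [Ring A] [Ring B] (g : A →+* B)

/-- The relations `b g(a) ⊗ m = b ⊗ a m` that turn `B ⊗_ℤ M` into `B ⊗_A M`. -/
def balancing (M : Type u) [AddCommGroup M] [Module A M] : Submodule B (B ⊗[ℤ] M) :=
  Submodule.span B {z | ∃ (b : B) (a : A) (m : M), z = (b * g a) ⊗ₜ[ℤ] m - b ⊗ₜ[ℤ] (a • m)}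

/-- The left `B`-module `B ⊗_A M`, where `B` is a right `A`-module through `g : A →+* B`. -/
abbrev BalancedTensor (M : Type u) [AddCommGroup M] [Module A M] : Type u :=
  (B ⊗[ℤ] M) ⧸ balancing g M

/-- The `B`-linear map `B ⊗_ℤ M → B ⊗_ℤ N`, `b ⊗ m ↦ b ⊗ φ m`. -/
def tensorMapInt {M N : Type u} [AddCommGroup M] [Module A M] [AddCommGroup N] [Module A N]
    (φ : M →ₗ[A] N) : (B ⊗[ℤ] M) →ₗ[B] (B ⊗[ℤ] N) :=
  TensorProduct.AlgebraTensorModule.map (LinearMap.id : B →ₗ[B] B) φ.toAddMonoidHom.toIntLinearMap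

@[simp] theorem tensorMapInt_tmul {M N : Type u} [AddCommGroup M] [Module A M] [AddCommGroup N]
    [Module A N] (φ : M →ₗ[A] N) (b : B) (m : M) :
    tensorMapInt φ (b ⊗ₜ[ℤ] m) = b ⊗ₜ[ℤ] φ m := rfl

theorem balancing_le_comap {M N : Type u} [AddCommGroup M] [Module A M] [AddCommGroup N]
    [Module A N] (φ : M →ₗ[A] N) :
    balancing g M ≤ (balancing g N).comap (tensorMapInt φ) := by
  refine Submodule.span_le.2 ?_
  rintro _ ⟨b, a, m, rfl⟩
  refine Submodule.subset_span ⟨b, a, φ m, ?_⟩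
  rw [map_sub, tensorMapInt_tmul, tensorMapInt_tmul, map_smul]

/-- The `B`-linear map `B ⊗_A M → B ⊗_A N`, `b ⊗ m ↦ b ⊗ φ m`. -/
def BalancedTensor.map {M N : Type u} [AddCommGroup M] [Module A M] [AddCommGroup N] [Module A N]
    (φ : M →ₗ[A] N) : BalancedTensor g M →ₗ[B] BalancedTensor g N :=
  Submodule.mapQ _ _ (tensorMapInt φ) (balancing_le_comap g φ)

/-- The class of the elementary tensor `b ⊗ m` in `B ⊗_A M`. -/
def BalancedTensor.tmul {M : Type u} [AddCommGroup M] [Module A M] (b : B) (m : M) :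
    BalancedTensor g M :=
  Submodule.Quotient.mk (b ⊗ₜ[ℤ] m)

theorem BalancedTensor.map_tmul {M N : Type u} [AddCommGroup M] [Module A M] [AddCommGroup N]
    [Module A N] (φ : M →ₗ[A] N) (b : B) (m : M) :
    BalancedTensor.map g φ (BalancedTensor.tmul g b m) = BalancedTensor.tmul g b (φ m) := rfl

theorem BalancedTensor.hom_ext {M : Type u} [AddCommGroup M] [Module A M]
    {P : Type u} [AddCommGroup P] [Module B P] {α β : BalancedTensor g M →ₗ[B] P}
    (h : ∀ b m, α (BalancedTensor.tmul g b m) = β (BalancedTensor.tmul g b m)) : α = β := by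
  refine LinearMap.ext fun z => ?_
  obtain ⟨z, rfl⟩ := Submodule.Quotient.mk_surjective _ z
  induction z using TensorProduct.induction_on with
  | zero => simp
  | tmul b m => exact h b m
  | add x y hx hy => rw [Submodule.Quotient.mk_add, map_add, map_add, hx, hy]

/-- The functor `M ↦ B ⊗_A M` from left `A`-modules to left `B`-modules. -/
def extendScalars : ModuleCat.{u} A ⥤ ModuleCat.{u} B where
  obj M := ModuleCat.of B (BalancedTensor g M)
  map φ := ModuleCat.ofHom (BalancedTensor.map g φ.hom)
  map_id M := by
    ext : 1
    exact BalancedTensor.hom_ext g fun b m => BalancedTensor.map_tmul g _ b m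
  map_comp φ ψ := by
    ext : 1
    refine BalancedTensor.hom_ext g fun b m => ?_
    rfl

instance : (extendScalars g).Additive where
  map_add {M N φ ψ} := by
    ext : 1
    refine BalancedTensor.hom_ext g fun b m => ?_
    change BalancedTensor.tmul g b (φ.hom m + ψ.hom m) =
      BalancedTensor.tmul g b (φ.hom m) + BalancedTensor.tmul g b (ψ.hom m)
    simp only [BalancedTensor.tmul, TensorProduct.tmul_add, Submodule.Quotient.mk_add]

end ExtendScalars

/-! ### Right modules -/

/-- The category of right `S`-modules: a right action of `S` is a left action of `Sᵐᵒᵖ`. -/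
abbrev RightMod (S : Type u) [Ring S] := ModuleCat.{u} Sᵐᵒᵖ

/-- For a ring homomorphism `f : S →+* S'`, the functor `M ↦ M ⊗_S S'` on right modules. In terms of
left modules over the opposite rings it is `M ↦ S'ᵐᵒᵖ ⊗_{Sᵐᵒᵖ} M`; the element `op t ⊗ m` of the
latter stands for `m ⊗ t`. -/
abbrev tensorRight {S S' : Type u} [Ring S] [Ring S'] (f : S →+* S') : RightMod S ⥤ RightMod S' :=
  extendScalars (RingHom.op f)

/-- For a ring homomorphism `f : S →+* S'`, restriction of scalars from right `S'`-modules to right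
`S`-modules. -/
abbrev restrictRight {S S' : Type u} [Ring S] [Ring S'] (f : S →+* S') :
    RightMod S' ⥤ RightMod S :=
  ModuleCat.restrictScalars (RingHom.op f)

/-- Chain complexes of right `S`-modules, indexed by `ℤ`, with differentials of degree `-1`. -/
abbrev Complexes (S : Type u) [Ring S] := ChainComplex (RightMod S) ℤ

section Complexes

variable {S : Type u} [Ring S]

/-- `C` vanishes outside a finite range of degrees. -/
def IsBounded (C : Complexes S) : Prop :=
  ∃ a b : ℤ, ∀ n : ℤ, n ∉ Set.Icc a b → Limits.IsZero (C.X n)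

/-- A complex of trivial vector bundles: all chain modules are finitely generated and free. -/
def IsFinitelyGeneratedFree (C : Complexes S) : Prop :=
  ∀ n : ℤ, Module.Finite Sᵐᵒᵖ (C.X n) ∧ Module.Free Sᵐᵒᵖ (C.X n)

/-- A strict perfect complex: bounded, with finitely generated projective chain modules. -/
def IsStrictPerfect (C : Complexes S) : Prop :=
  IsBounded C ∧ ∀ n : ℤ, Module.Finite Sᵐᵒᵖ (C.X n) ∧ Module.Projective Sᵐᵒᵖ (C.X n)

/-- Two complexes are quasi-isomorphic if they are connected by a finite chain of
quasi-isomorphisms, pointing in either direction. -/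
def QuasiIsomorphic (C D : Complexes S) : Prop :=
  Relation.EqvGen (fun X Y : Complexes S => ∃ f : X ⟶ Y, QuasiIso f) C D

/-- An `S`-perfect complex: quasi-isomorphic to a strict perfect complex. -/
def IsPerfect (C : Complexes S) : Prop :=
  ∃ D : Complexes S, IsStrictPerfect D ∧ QuasiIsomorphic C D

/-- An `S`-finitely dominated complex: chain homotopy equivalent to a strict perfect complex. -/
def IsFinitelyDominated (C : Complexes S) : Prop :=
  ∃ D : Complexes S, IsStrictPerfect D ∧ Nonempty (HomotopyEquiv C D)

end Complexes

/-! ### The Novikov rings -/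

section NovikovRings

variable (R : Type u) [Ring R]

/-- The group homomorphism `k ↦ y ^ (ε k)` from `ℤ` to the units of `R((y))`. -/
def monomialHom (ε : ℤ) : Multiplicative ℤ →* R⸨X⸩ where
  toFun k := HahnSeries.single (ε * k.toAdd) 1
  map_one' := by simp
  map_mul' k l := by simp [mul_add]

/-- The ring homomorphism `R[x, x⁻¹] → R((y))` that is the identity on `R` and sends `x` to
`y ^ ε`. -/
def toSeries (ε : ℤ) : R[T;T⁻¹] →+* R⸨X⸩ :=
  AddMonoidAlgebra.liftNCRingHom HahnSeries.C (monomialHom R ε) fun r k => by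
    simp [Commute, SemiconjBy, monomialHom, HahnSeries.C_apply]

theorem toSeries_C (ε : ℤ) (r : R) : toSeries R ε (LaurentPolynomial.C r) = HahnSeries.C r := by
  change AddMonoidAlgebra.liftNC _ _ (AddMonoidAlgebra.single 0 r) = _
  rw [AddMonoidAlgebra.liftNC_single]
  simp [monomialHom]

theorem toSeries_T (ε k : ℤ) :
    toSeries R ε (LaurentPolynomial.T k) = HahnSeries.single (ε * k) (1 : R) := by
  change AddMonoidAlgebra.liftNC _ _ (AddMonoidAlgebra.single k 1) = _
  rw [AddMonoidAlgebra.liftNC_single]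
  simp [monomialHom]

/-- The inclusion `R[x, x⁻¹] → R((x))` into the formal Laurent series in `x`. -/
def toNovikovZero : R[T;T⁻¹] →+* R⸨X⸩ := toSeries R 1

/-- The inclusion `R[x, x⁻¹] → R((x⁻¹))` into the formal Laurent series in `x⁻¹`: the ring
`R((x⁻¹))` is the ring of Laurent series in a variable `y`, which is the image of `x⁻¹`. -/
def toNovikovInfinity : R[T;T⁻¹] →+* R⸨X⸩ := toSeries R (-1)

variable {R}

/-- The complex `C ⊗_{R[x,x⁻¹]} R((x))` of right `R((x))`-modules. -/
def novikovZero (C : Complexes R[T;T⁻¹]) : Complexes R⸨X⸩ :=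
  ((tensorRight (toNovikovZero R)).mapHomologicalComplex (ComplexShape.down ℤ)).obj C

/-- The complex `C ⊗_{R[x,x⁻¹]} R((x⁻¹))` of right `R((x⁻¹))`-modules. -/
def novikovInfinity (C : Complexes R[T;T⁻¹]) : Complexes R⸨X⸩ :=
  ((tensorRight (toNovikovInfinity R)).mapHomologicalComplex (ComplexShape.down ℤ)).obj C

/-- The push-forward `p_* C`: the complex `C`, regarded as a complex of right `R`-modules. -/
def pushforward (C : Complexes R[T;T⁻¹]) : Complexes R :=
  ((restrictRight (LaurentPolynomial.C : R →+* R[T;T⁻¹])).mapHomologicalComplex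
    (ComplexShape.down ℤ)).obj C

end NovikovRings

end Novikov

end

/-! The plan is to show that the identity of $C$, seen over $R$, is null-homotopic modulo maps with
image in a finitely generated submodule. Such a null-homotopy is called a parametrix, and for a
bounded complex of projectives its existence forces finite domination.

Put $y = x^{\varepsilon}$ with $\varepsilon = \pm 1$. The complex $C \otimes R((y))$ is bounded,
acyclic and free, so it is contractible. Truncating the matrix entries of a contraction gives
Laurent polynomial maps $K$ on $C$ such that all entries of $v = 1 - (dK + Kd)$ have order at least
$1$ in $y$ (`exists_approximate_contraction`). Thus $v$ strictly raises the degree in $x$ if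
$\varepsilon = 1$, and strictly lowers it if $\varepsilon = -1$.

Cut $C$ at degree $0$ with an $R$-linear projection $\pi$: onto the negative degrees for
$\varepsilon = 1$, onto the nonnegative ones for $\varepsilon = -1$. Then $\pi v \pi$ pushes each
half towards the cut, hence is locally nilpotent, and $G = (1 - \pi v \pi)^{-1}$ exists over $R$.
Both $d$ and $K$ commute with $\pi$ except near the cut, which involves only finitely many basis
vectors over $R$. So $G \pi K$ is a null-homotopy of $\pi$ modulo finite type
(`exists_homotopy_projection`), and the sum over the two halves is a parametrix
(`hasParametrix_of_shift`).

Given a parametrix, the chain modules are made finitely generated from the bottom up. If everything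
below degree $k$ is finitely generated, then finitely many elements together with the boundaries
generate $C_k$. Replacing $C_k$ by a finitely generated free module, and $C_{k+1}$ by a pullback,
does not change the homotopy type (`replacementHomotopyEquiv`). In the top degree nothing is left to
replace (`HasParametrix.exists_homotopyEquiv`). -/

noncomputable section

namespace Novikov

/-! ### Maps of finite type and parametrices -/

section FiniteType

variable {S : Type*} [Ring S] {M N P : Type*} [AddCommGroup M] [Module S M] [AddCommGroup N]
  [Module S N] [AddCommGroup P] [Module S P]

/-- A linear map is of finite type if its range lies in a finitely generated submodule. -/
def IsFiniteType (f : M →ₗ[S] N) : Prop :=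
  ∃ L : Submodule S N, L.FG ∧ ∀ x, f x ∈ L

namespace IsFiniteType

theorem add {f g : M →ₗ[S] N} (hf : IsFiniteType f) (hg : IsFiniteType g) :
    IsFiniteType (f + g) := by
  obtain ⟨L, hL, hfL⟩ := hf
  obtain ⟨L', hL', hgL⟩ := hg
  exact ⟨L ⊔ L', hL.sup hL', fun x =>
    add_mem (Submodule.mem_sup_left (hfL x)) (Submodule.mem_sup_right (hgL x))⟩

theorem neg {f : M →ₗ[S] N} (hf : IsFiniteType f) : IsFiniteType (-f) := by
  obtain ⟨L, hL, hfL⟩ := hf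
  exact ⟨L, hL, fun x => L.neg_mem (hfL x)⟩

theorem comp_left {f : M →ₗ[S] N} (hf : IsFiniteType f) (g : N →ₗ[S] P) :
    IsFiniteType (g ∘ₗ f) := by
  obtain ⟨L, hL, hfL⟩ := hf
  exact ⟨L.map g, hL.map g, fun x => Submodule.mem_map_of_mem (hfL x)⟩

theorem comp_right {f : N →ₗ[S] P} (hf : IsFiniteType f) (g : M →ₗ[S] N) :
    IsFiniteType (f ∘ₗ g) := by
  obtain ⟨L, hL, hfL⟩ := hf
  exact ⟨L, hL, fun x => hfL (g x)⟩

end IsFiniteType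

end FiniteType

variable {S : Type u} [Ring S]

/-- A family `h` of linear maps of degree one such that `1 - (d h + h d)` is of finite type in each
degree. -/
def HasParametrix (C : ChainComplex (ModuleCat.{u} S) ℤ) : Prop :=
  ∃ h : ∀ i j, C.X i →ₗ[S] C.X j, ∀ n, IsFiniteType (LinearMap.id -
    ((C.d (n + 1) n).hom ∘ₗ h n (n + 1) + h (n - 1) n ∘ₗ (C.d n (n - 1)).hom))

/-- A homotopy between chain maps from a family of maps of degree one. -/
def homotopyOfFamily {C D : ChainComplex (ModuleCat.{u} S) ℤ} {f g : C ⟶ D}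
    (h : ∀ i j, C.X i →ₗ[S] D.X j)
    (comm : ∀ n x, (f.f n).hom x = h (n - 1) n ((C.d n (n - 1)).hom x) +
      (D.d (n + 1) n).hom (h n (n + 1) x) + (g.f n).hom x) : Homotopy f g where
  hom i j := if (ComplexShape.down ℤ).Rel j i then ModuleCat.ofHom (h i j) else 0
  zero i j hij := if_neg hij
  comm n := by
    have h₁ : (ComplexShape.down ℤ).Rel n (n - 1) := by simp
    have h₂ : (ComplexShape.down ℤ).Rel (n + 1) n := by simp
    rw [dNext_eq _ h₁, prevD_eq _ h₂, if_pos h₁, if_pos h₂]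
    ext x
    exact comm n x

theorem homotopy_apply {C D : ChainComplex (ModuleCat.{u} S) ℤ} {f g : C ⟶ D} (h : Homotopy f g)
    (n : ℤ) (x : C.X n) : (f.f n).hom x = (h.hom (n - 1) n).hom ((C.d n (n - 1)).hom x) +
      (D.d (n + 1) n).hom ((h.hom n (n + 1)).hom x) + (g.f n).hom x := by
  have h₁ : (ComplexShape.down ℤ).Rel n (n - 1) := by simp
  have h₂ : (ComplexShape.down ℤ).Rel (n + 1) n := by simp
  have := h.comm n
  rw [dNext_eq _ h₁, prevD_eq _ h₂] at this
  rw [this]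
  rfl

theorem hom_comm_apply {C D : ChainComplex (ModuleCat.{u} S) ℤ} (f : C ⟶ D) (i j : ℤ) (x : C.X i) :
    (f.f j).hom ((C.d i j).hom x) = (D.d i j).hom ((f.f i).hom x) := by
  have := f.comm i j
  exact congr($(this.symm).hom x)

theorem d_d_apply (C : ChainComplex (ModuleCat.{u} S) ℤ) (i j k : ℤ) (x : C.X i) :
    (C.d j k).hom ((C.d i j).hom x) = 0 := by
  have := C.d_comp_d i j k
  exact congr($(this).hom x)

theorem d_apply_eq_zero (C : ChainComplex (ModuleCat.{u} S) ℤ) {i j : ℤ} (h : j + 1 ≠ i)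
    (x : C.X i) : (C.d i j).hom x = 0 := by
  rw [C.shape i j (by simpa using h)]
  rfl

/-- With $f, g$ the two maps of the equivalence and $fg = 1 + dk + kd$, the family $fhg - k$ has
error term $f(1 - dh - hd)g$, which is again of finite type. -/
theorem HasParametrix.of_homotopyEquiv {C D : ChainComplex (ModuleCat.{u} S) ℤ}
    (e : HomotopyEquiv C D) (hC : HasParametrix C) : HasParametrix D := by
  obtain ⟨h, hh⟩ := hC
  refine ⟨fun i j => (e.hom.f j).hom ∘ₗ h i j ∘ₗ (e.inv.f i).hom -
    (e.homotopyInvHomId.hom i j).hom, fun n => ?_⟩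
  convert ((hh n).comp_right (e.inv.f n).hom).comp_left (e.hom.f n).hom using 1
  ext x
  have := homotopy_apply e.homotopyInvHomId n x
  simp only [HomologicalComplex.comp_f, ModuleCat.hom_comp, LinearMap.comp_apply,
    HomologicalComplex.id_f, ModuleCat.hom_id, LinearMap.id_apply] at this
  simp only [LinearMap.sub_apply, LinearMap.add_apply, LinearMap.comp_apply, LinearMap.id_apply,
    map_sub, map_add, ← hom_comm_apply]
  rw [this]
  abel

/-! ### Replacing one chain module by a given module -/

section Attach

variable {C : ChainComplex (ModuleCat.{u} S) ℤ} {F : Type u} [AddCommGroup F] [Module S F]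
  (ι : ∀ n, F →ₗ[S] C.X n) (k : ℤ)

/-- The chain modules of the complex in which `C_k` is replaced by `F` and `C_{k+1}` by the pullback
of `C_{k+1} → C_k ← F`. -/
def replacementModule (n : ℤ) : Submodule S (C.X n × F) where
  -- Conditional equations put all degrees inside $C_n \times F$, without a case split on types: the
  -- result is a copy of $F$ for $n = k$, the pullback for $n = k + 1$, and $C_n$ otherwise. Only
  -- the component `ι k` matters.
  carrier := {p | (n = k → p.1 = ι n p.2) ∧ (n = k + 1 → (C.d n k).hom p.1 = ι k p.2) ∧
    (n ≠ k → n ≠ k + 1 → p.2 = 0)}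
  zero_mem' := by simp
  add_mem' {p q} hp hq := by
    refine ⟨fun h => ?_, fun h => ?_, fun h h' => ?_⟩
    · rw [Prod.fst_add, Prod.snd_add, map_add, hp.1 h, hq.1 h]
    · rw [Prod.fst_add, Prod.snd_add, map_add, map_add, hp.2.1 h, hq.2.1 h]
    · rw [Prod.snd_add, hp.2.2 h h', hq.2.2 h h', add_zero]
  smul_mem' c p hp := by
    refine ⟨fun h => ?_, fun h => ?_, fun h h' => ?_⟩
    · rw [Prod.smul_fst, Prod.smul_snd, map_smul, hp.1 h]
    · rw [Prod.smul_fst, Prod.smul_snd, map_smul, map_smul, hp.2.1 h]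
    · rw [Prod.smul_snd, hp.2.2 h h', smul_zero]

/-- The differential of the replacement complex. -/
def replacementD (i j : ℤ) : replacementModule ι k i →ₗ[S] replacementModule ι k j :=
  ((((C.d i j).hom ∘ₗ LinearMap.fst S _ _).prod
    (if i = k + 1 ∧ j = k then LinearMap.snd S _ _ else 0)) ∘ₗ
      (replacementModule ι k i).subtype).codRestrict _ fun p => by
    obtain ⟨p, hp⟩ := p
    refine ⟨fun h => ?_, fun h => ?_, fun h h' => ?_⟩
    · subst h
      by_cases hi : i = j + 1
      · simpa [hi] using hp.2.1 hi
      · simpa [hi] using d_apply_eq_zero C (Ne.symm hi) p.1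
    · have : j ≠ k := by omega
      simpa [this] using d_d_apply C i j k p.1
    · simp [h]

theorem replacementD_fst (i j : ℤ) (p : replacementModule ι k i) :
    (replacementD ι k i j p).1.1 = (C.d i j).hom p.1.1 := rfl

theorem replacementD_snd (i j : ℤ) (p : replacementModule ι k i) :
    (replacementD ι k i j p).1.2 = if i = k + 1 ∧ j = k then p.1.2 else 0 := by
  change (if i = k + 1 ∧ j = k then LinearMap.snd S (C.X i) F else 0) p.1 = _
  split_ifs <;> rfl

/-- The complex in which `C_k` is replaced by `F`, and `C_{k+1}` by the pullback of
`C_{k+1} → C_k ← F`. -/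
def replacement : ChainComplex (ModuleCat.{u} S) ℤ where
  X n := ModuleCat.of S (replacementModule ι k n)
  d i j := ModuleCat.ofHom (replacementD ι k i j)
  shape i j hij := by
    have hij : j + 1 ≠ i := by simpa using hij
    ext p : 2
    refine Subtype.ext (Prod.ext ?_ ?_)
    · exact d_apply_eq_zero C hij _
    · refine (replacementD_snd ι k i j p).trans (if_neg ?_)
      omega
  d_comp_d' i j l _ _ := by
    ext p : 2
    refine Subtype.ext (Prod.ext ?_ ?_)
    · exact d_d_apply C i j l _
    · refine (replacementD_snd ι k j l _).trans ?_
      split_ifs with h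
      · refine (replacementD_snd ι k i j p).trans (if_neg ?_)
        omega
      · rfl

end Attach

section Replacement

variable {S : Type u} [Ring S] {C : ChainComplex (ModuleCat.{u} S) ℤ}
  {F : Type u} [AddCommGroup F] [Module S F]
  (ι : ∀ n, F →ₗ[S] C.X n) (k : ℤ)

/-- The projection of the replacement complex onto `C`. -/
def replacementProj : replacement ι k ⟶ C where
  f n := ModuleCat.ofHom (LinearMap.fst S _ _ ∘ₗ (replacementModule ι k n).subtype)
  comm' _ _ _ := rfl

variable (σ : C.X k →ₗ[S] C.X (k + 1)) (τ : C.X k →ₗ[S] F)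

/-- `σ`, extended by zero to a family of maps. -/
def extendHomotopy : ∀ i j, C.X i →ₗ[S] C.X j :=
  Pi.single (M := fun i => ∀ j, C.X i →ₗ[S] C.X j) k
    (Pi.single (M := fun j => C.X k →ₗ[S] C.X j) (k + 1) σ)

theorem extendHomotopy_self : extendHomotopy k σ k (k + 1) = σ := by
  simp [extendHomotopy]

theorem extendHomotopy_of_ne_left {i j : ℤ} (h : i ≠ k) : extendHomotopy k σ i j = 0 := by
  simp [extendHomotopy, h]

theorem extendHomotopy_of_ne_right {i j : ℤ} (h : j ≠ k + 1) : extendHomotopy k σ i j = 0 := by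
  by_cases hi : i = k
  · subst hi
    simp [extendHomotopy, h]
  · exact extendHomotopy_of_ne_left k σ hi

/-- `τ`, extended by zero to a family of maps. -/
def extendMap : ∀ i, C.X i →ₗ[S] F :=
  Pi.single (M := fun i => C.X i →ₗ[S] F) k τ

theorem extendMap_self : extendMap k τ k = τ := by
  simp [extendMap]

theorem extendMap_of_ne {i : ℤ} (h : i ≠ k) : extendMap k τ i = 0 := by
  simp [extendMap, h]

/-- Replaces an index such as `k + 1 - 1` by `k` in both dependent positions at once. -/
theorem comp_d_congr {M : Type*} [AddCommGroup M] [Module S M] (h : ∀ i, C.X i →ₗ[S] M)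
    {i j l : ℤ} (hl : l = j) (x : C.X i) : h l ((C.d i l).hom x) = h j ((C.d i j).hom x) := by
  rw [hl]

variable {σ τ} (hστ : ∀ x, (C.d (k + 1) k).hom (σ x) + ι k (τ x) = x)

-- The hypothesis says that $(\sigma, \tau)$ splits $(d, \iota) : C_{k+1} \oplus F \to C_k$.
-- Subtracting $d\sigma + \sigma d$ from the identity leaves $\iota\tau$ in degree $k$, so the map
-- factors through $F$ there.
include hστ in
theorem replacementSection_mem (n : ℤ) (x : C.X n) :
    (x - extendHomotopy k σ (n - 1) n ((C.d n (n - 1)).hom x) -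
        (C.d (n + 1) n).hom (extendHomotopy k σ n (n + 1) x),
      extendMap k τ n x + extendMap k τ (n - 1) ((C.d n (n - 1)).hom x)) ∈
      replacementModule ι k n := by
  refine ⟨fun h => ?_, fun h => ?_, fun h h' => ?_⟩
  · subst h
    rw [extendHomotopy_of_ne_left n σ (by omega : n - 1 ≠ n), extendHomotopy_self, extendMap_self,
      extendMap_of_ne n τ (by omega : n - 1 ≠ n)]
    simp only [LinearMap.zero_apply, sub_zero, add_zero]
    nth_rw 1 [← hστ x]
    abel
  · subst h
    rw [extendHomotopy_of_ne_left k σ (by omega : k + 1 ≠ k),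
      extendMap_of_ne k τ (by omega : k + 1 ≠ k)]
    simp only [LinearMap.zero_apply, map_zero, sub_zero, zero_add, map_sub]
    rw [comp_d_congr (fun i => extendHomotopy k σ i (k + 1)) (add_sub_cancel_right k 1),
      comp_d_congr (extendMap k τ) (add_sub_cancel_right k 1), extendHomotopy_self, extendMap_self]
    nth_rw 1 [← hστ ((C.d (k + 1) k).hom x)]
    abel
  · change extendMap k τ n x + extendMap k τ (n - 1) ((C.d n (n - 1)).hom x) = 0
    rw [extendMap_of_ne k τ h, extendMap_of_ne k τ (by omega : n - 1 ≠ k)]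
    simp

/-- The chain map from `C` to the replacement complex given by a section of
`C_{k+1} ⊕ F → C_k`. -/
def replacementSection : C ⟶ replacement ι k where
  f n := ModuleCat.ofHom (LinearMap.codRestrict _
    ((LinearMap.id - extendHomotopy k σ (n - 1) n ∘ₗ (C.d n (n - 1)).hom -
        (C.d (n + 1) n).hom ∘ₗ extendHomotopy k σ n (n + 1)).prod
      (extendMap k τ n + extendMap k τ (n - 1) ∘ₗ (C.d n (n - 1)).hom))
    (replacementSection_mem ι k hστ n))
  comm' i j hij := by
    obtain rfl : j + 1 = i := hij
    ext x : 2
    refine Subtype.ext (Prod.ext ?_ ?_)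
    · change (C.d (j + 1) j).hom (x -
        extendHomotopy k σ (j + 1 - 1) (j + 1) ((C.d (j + 1) (j + 1 - 1)).hom x) -
        (C.d (j + 1 + 1) (j + 1)).hom (extendHomotopy k σ (j + 1) (j + 1 + 1) x)) =
        (C.d (j + 1) j).hom x - extendHomotopy k σ (j - 1) j
          ((C.d j (j - 1)).hom ((C.d (j + 1) j).hom x)) -
          (C.d (j + 1) j).hom (extendHomotopy k σ j (j + 1) ((C.d (j + 1) j).hom x))
      rw [comp_d_congr (fun i => extendHomotopy k σ i (j + 1)) (add_sub_cancel_right j 1)]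
      simp [d_d_apply]
    · refine (replacementD_snd ι k (j + 1) j _).trans ?_
      change (if j + 1 = k + 1 ∧ j = k then extendMap k τ (j + 1) x +
        extendMap k τ (j + 1 - 1) ((C.d (j + 1) (j + 1 - 1)).hom x) else 0) =
        extendMap k τ j ((C.d (j + 1) j).hom x) + extendMap k τ (j - 1)
          ((C.d j (j - 1)).hom ((C.d (j + 1) j).hom x))
      rw [d_d_apply, map_zero, add_zero]
      by_cases h : j = k
      · subst h
        rw [if_pos ⟨rfl, rfl⟩, extendMap_of_ne j τ (by omega : j + 1 ≠ j),
          comp_d_congr (extendMap j τ) (add_sub_cancel_right j 1)]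
        simp
      · rw [if_neg (by tauto), extendMap_of_ne k τ h]
        rfl

/-- The maps that make up the null-homotopy of `1 - s p` on the replacement complex, where
`p` is the projection to `C` and `s` its homotopy inverse. -/
def replacementHomotopy (i j : ℤ) :
    replacementModule ι k i →ₗ[S] replacementModule ι k j :=
  if h : i = k ∧ j = k + 1 then
    LinearMap.codRestrict _ (((extendHomotopy k σ i j ∘ₗ LinearMap.fst S _ _).prod
      (LinearMap.snd S _ _ - extendMap k τ i ∘ₗ LinearMap.fst S _ _)) ∘ₗ
        (replacementModule ι k i).subtype) fun p => by
      obtain ⟨rfl, rfl⟩ := h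
      refine ⟨fun h => by omega, fun _ => ?_, fun _ h => absurd rfl h⟩
      change (C.d (i + 1) i).hom (extendHomotopy i σ i (i + 1) p.1.1) =
        ι i (p.1.2 - extendMap i τ i p.1.1)
      rw [extendHomotopy_self, extendMap_self, map_sub, ← p.2.1 rfl]
      nth_rw 2 [← hστ p.1.1]
      abel
  else 0

theorem replacementHomotopy_fst (i j : ℤ) (p : replacementModule ι k i) :
    (replacementHomotopy ι k hστ i j p).1.1 = extendHomotopy k σ i j p.1.1 := by
  rw [replacementHomotopy]
  split_ifs with h
  · rfl
  · rw [not_and_or] at h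
    rcases h with h | h
    · rw [extendHomotopy_of_ne_left k σ h]; rfl
    · rw [extendHomotopy_of_ne_right k σ h]; rfl

theorem replacementHomotopy_snd (i j : ℤ) (p : replacementModule ι k i) :
    (replacementHomotopy ι k hστ i j p).1.2 =
      if i = k ∧ j = k + 1 then p.1.2 - extendMap k τ i p.1.1 else 0 := by
  rw [replacementHomotopy]
  split_ifs with h <;> rfl

/-- The replacement complex is homotopy equivalent to `C`. -/
def replacementHomotopyEquiv : HomotopyEquiv C (replacement ι k) where
  hom := replacementSection ι k hστ
  inv := replacementProj ι k
  homotopyHomInvId := homotopyOfFamily (fun i j => -extendHomotopy k σ i j) fun n x => by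
    change x - extendHomotopy k σ (n - 1) n ((C.d n (n - 1)).hom x) -
        (C.d (n + 1) n).hom (extendHomotopy k σ n (n + 1) x) =
      -extendHomotopy k σ (n - 1) n ((C.d n (n - 1)).hom x) +
        (C.d (n + 1) n).hom (-extendHomotopy k σ n (n + 1) x) + x
    rw [map_neg]
    abel
  homotopyInvHomId := homotopyOfFamily (fun i j => -replacementHomotopy ι k hστ i j)
    fun n (p : replacementModule ι k n) => by
    refine Subtype.ext (Prod.ext ?_ ?_)
    · change p.1.1 - extendHomotopy k σ (n - 1) n ((C.d n (n - 1)).hom p.1.1) -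
          (C.d (n + 1) n).hom (extendHomotopy k σ n (n + 1) p.1.1) =
        -(replacementHomotopy ι k hστ (n - 1) n (replacementD ι k n (n - 1) p)).1.1 +
        (C.d (n + 1) n).hom (-(replacementHomotopy ι k hστ n (n + 1) p).1.1) + p.1.1
      rw [replacementHomotopy_fst, replacementHomotopy_fst, replacementD_fst, map_neg]
      abel
    · change extendMap k τ n p.1.1 + extendMap k τ (n - 1) ((C.d n (n - 1)).hom p.1.1) =
        -(replacementHomotopy ι k hστ (n - 1) n (replacementD ι k n (n - 1) p)).1.2 +
        (replacementD ι k (n + 1) n (-replacementHomotopy ι k hστ n (n + 1) p)).1.2 + p.1.2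
      rw [replacementHomotopy_snd, replacementD_snd, replacementD_snd, replacementD_fst]
      change _ = _ + (if n + 1 = k + 1 ∧ n = k then
        -(replacementHomotopy ι k hστ n (n + 1) p).1.2 else 0) + _
      rw [replacementHomotopy_snd]
      by_cases h : n = k
      · subst h
        rw [extendMap_of_ne n τ (by omega : n - 1 ≠ n)]
        simp
      · by_cases h' : n = k + 1
        · subst h'
          rw [extendMap_of_ne k τ h]
          simp
        · rw [extendMap_of_ne k τ h, extendMap_of_ne k τ (by omega : n - 1 ≠ k), p.2.2.2 h h']
          have : ¬ (n - 1 = k ∧ n = k + 1) := by tauto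
          have : ¬ (n + 1 = k + 1 ∧ n = k) := by tauto
          simp [*]

/-- In degree $k + 1$ the pullback is the kernel of $(c, f) \mapsto dc - \iota f$, which is split by
$(\sigma, -\tau)$; so it is a direct summand of $C_{k+1} \oplus F$. -/
theorem replacementModule_projective [Module.Projective S F]
    (hC : ∀ n, Module.Projective S (C.X n)) (hστ : ∀ x, (C.d (k + 1) k).hom (σ x) + ι k (τ x) = x)
    (n : ℤ) : Module.Projective S (replacementModule ι k n) := by
  by_cases h : n = k
  · subst h
    refine Module.Projective.of_split (LinearMap.snd S _ _ ∘ₗ Submodule.subtype _)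
      (LinearMap.codRestrict _ ((ι n).prod LinearMap.id) fun f =>
        ⟨fun _ => rfl, fun h => by omega, fun h => absurd rfl h⟩) ?_
    ext p : 1
    exact Subtype.ext (Prod.ext (p.2.1 rfl).symm rfl)
  · by_cases h' : n = k + 1
    · subst h'
      refine Module.Projective.of_split (Submodule.subtype _)
        (LinearMap.codRestrict _ (LinearMap.id -
          (σ.prod (-τ)) ∘ₗ ((C.d (k + 1) k).hom ∘ₗ LinearMap.fst S _ _ -
            ι k ∘ₗ LinearMap.snd S _ _)) fun p =>
          ⟨fun h => by omega, fun _ => ?_, fun _ h => absurd rfl h⟩) ?_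
      · change (C.d (k + 1) k).hom (p.1 - σ ((C.d (k + 1) k).hom p.1 - ι k p.2)) =
          ι k (p.2 - -τ ((C.d (k + 1) k).hom p.1 - ι k p.2))
        have := hστ ((C.d (k + 1) k).hom p.1 - ι k p.2)
        rw [map_sub, sub_neg_eq_add, map_add, sub_eq_iff_eq_add, add_assoc,
          add_comm (ι k (τ _)), this]
        abel
      · ext p : 1
        refine Subtype.ext ?_
        change p.1 - (σ.prod (-τ)) ((C.d (k + 1) k).hom p.1.1 - ι k p.1.2) = p.1
        rw [p.2.2.1 rfl, sub_self, map_zero, sub_zero]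
    · refine Module.Projective.of_split (LinearMap.fst S _ _ ∘ₗ Submodule.subtype _)
        (LinearMap.codRestrict _ (LinearMap.inl S _ _) fun c =>
          ⟨fun h'' => absurd h'' h, fun h'' => absurd h'' h', fun _ _ => rfl⟩) ?_
      ext p : 1
      exact Subtype.ext (Prod.ext rfl (p.2.2.2 h h').symm)

theorem replacementModule_finite [Module.Finite S F] (hC : ∀ n < k, Module.Finite S (C.X n))
    (n : ℤ) (hn : n ≤ k) : Module.Finite S (replacementModule ι k n) := by
  rcases hn.lt_or_eq with hn | rfl
  · have := hC n hn
    refine Module.Finite.of_surjective (LinearMap.codRestrict (replacementModule ι k n)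
      (LinearMap.inl S (C.X n) F) fun c =>
        ⟨fun h => absurd h hn.ne, fun h => by omega, fun _ _ => rfl⟩) fun p => ⟨p.1.1, ?_⟩
    exact Subtype.ext (Prod.ext rfl (p.2.2.2 hn.ne (by omega)).symm)
  · refine Module.Finite.of_surjective (LinearMap.codRestrict (replacementModule ι n n)
      ((ι n).prod LinearMap.id) fun f =>
        ⟨fun _ => rfl, fun h => by omega, fun h => absurd rfl h⟩) fun p => ⟨p.1.2, ?_⟩
    exact Subtype.ext (Prod.ext (p.2.1 rfl).symm rfl)

theorem replacementModule_subsingleton {n : ℤ} (hC : Subsingleton (C.X n)) (h : n ≠ k)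
    (h' : n ≠ k + 1) : Subsingleton (replacementModule ι k n) :=
  ⟨fun p q => Subtype.ext (Prod.ext (Subsingleton.elim _ _)
    ((p.2.2.2 h h').trans (q.2.2.2 h h').symm))⟩

end Replacement

/-! ### From a parametrix to a strict perfect complex -/

section StrictPerfect

variable {S : Type u} [Ring S]

/-- One step of the induction on degrees. Degree $k$ becomes finitely generated, possibly at the
cost of degree $k + 1$, which the next step repairs. -/
theorem exists_homotopyEquiv_finite_le {C : ChainComplex (ModuleCat.{u} S) ℤ} {k : ℤ}
    (hproj : ∀ n, Module.Projective S (C.X n)) (hC : HasParametrix C)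
    (hfin : ∀ n < k, Module.Finite S (C.X n)) :
    ∃ D : ChainComplex (ModuleCat.{u} S) ℤ, Nonempty (HomotopyEquiv C D) ∧
      (∀ n, Module.Projective S (D.X n)) ∧ (∀ n ≤ k, Module.Finite S (D.X n)) ∧
      ∀ n, n ≠ k → n ≠ k + 1 → Subsingleton (C.X n) → Subsingleton (D.X n) := by
  obtain ⟨h, hh⟩ := hC
  obtain ⟨L, hL, hφ⟩ := hh k
  have := hfin (k - 1) (by omega)
  have hL' : (L ⊔ LinearMap.range (h (k - 1) k)).FG := hL.sup Submodule.FG.of_finite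
  obtain ⟨m, w, hw⟩ := Submodule.fg_iff_exists_fin_generating_family.1 hL'
  -- Free on generators of $L + h(C_{k-1})$, which is finitely generated because $C_{k-1}$ is.
  let F : Type u := ULift.{u} (Fin m) →₀ S
  let ι₀ : F →ₗ[S] C.X k := Finsupp.linearCombination S (w ∘ ULift.down)
  have hι₀ : LinearMap.range ι₀ = L ⊔ LinearMap.range (h (k - 1) k) := by
    rw [Finsupp.range_linearCombination, ← hw, ULift.down_surjective.range_comp]
  let ι : ∀ n, F →ₗ[S] C.X n := Pi.single (M := fun n => F →ₗ[S] C.X n) k ι₀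
  have hι : ι k = ι₀ := by simp [ι]
  have hsurj : Function.Surjective ((C.d (k + 1) k).hom.coprod (ι k)) := by
    rw [← LinearMap.range_eq_top, LinearMap.range_coprod, hι, hι₀, eq_top_iff]
    intro x _
    have hx := hφ x
    -- Reads $x = dhx + (1 - dh - hd)x + hdx$: a boundary, an element of $L$, and an element of
    -- $h(C_{k-1})$.
    have : x = (C.d (k + 1) k).hom (h k (k + 1) x) + (((LinearMap.id : C.X k →ₗ[S] C.X k) -
      ((C.d (k + 1) k).hom ∘ₗ h k (k + 1) + h (k - 1) k ∘ₗ (C.d k (k - 1)).hom)) x +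
        h (k - 1) k ((C.d k (k - 1)).hom x)) := by
      simp only [LinearMap.sub_apply, LinearMap.add_apply, LinearMap.comp_apply, LinearMap.id_apply]
      abel
    rw [this]
    exact Submodule.add_mem_sup ⟨_, rfl⟩ (Submodule.add_mem_sup hx ⟨_, rfl⟩)
  have := hproj k
  obtain ⟨s, hs⟩ := Module.projective_lifting_property _ LinearMap.id hsurj
  have hστ : ∀ x, (C.d (k + 1) k).hom ((LinearMap.fst S _ _ ∘ₗ s) x) +
      ι k ((LinearMap.snd S _ _ ∘ₗ s) x) = x := fun x => LinearMap.congr_fun hs x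
  exact ⟨replacement ι k, ⟨replacementHomotopyEquiv ι k hστ⟩,
    replacementModule_projective ι k hproj hστ, replacementModule_finite ι k hfin,
    fun n h h' hn => replacementModule_subsingleton ι k hn h h'⟩

theorem exists_homotopyEquiv_finite_lt {C : ChainComplex (ModuleCat.{u} S) ℤ} {a b : ℤ}
    (hproj : ∀ n, Module.Projective S (C.X n)) (hC : HasParametrix C)
    (ha : ∀ n < a, Subsingleton (C.X n)) (hb : ∀ n > b + 1, Subsingleton (C.X n)) (k : ℤ)
    (hk : a ≤ k) (hkb : k ≤ b + 1) :
    ∃ D : ChainComplex (ModuleCat.{u} S) ℤ, Nonempty (HomotopyEquiv C D) ∧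
      (∀ n, Module.Projective S (D.X n)) ∧ (∀ n < k, Module.Finite S (D.X n)) ∧
      (∀ n < a, Subsingleton (D.X n)) ∧ (∀ n > b + 1, Subsingleton (D.X n)) := by
  induction k, hk using Int.leInduction with
  | base => exact ⟨C, ⟨HomotopyEquiv.refl C⟩, hproj, fun n hn => by
      have := ha n hn; infer_instance, ha, hb⟩
  | succ k hk ih =>
    obtain ⟨D, ⟨e⟩, hD, hfin, hDa, hDb⟩ := ih (by omega)
    obtain ⟨D', ⟨e'⟩, hD', hfin', hsub⟩ :=
      exists_homotopyEquiv_finite_le hD (hC.of_homotopyEquiv e) hfin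
    exact ⟨D', ⟨e.trans e'⟩, hD', fun n hn => hfin' n (by omega),
      fun n hn => hsub n (by omega) (by omega) (hDa n hn),
      fun n hn => hsub n (by omega) (by omega) (hDb n hn)⟩

/-- A bounded complex of projective modules with a parametrix is homotopy equivalent to a bounded
complex of finitely generated projective modules. -/
theorem HasParametrix.exists_homotopyEquiv {C : ChainComplex (ModuleCat.{u} S) ℤ} {a b : ℤ}
    (hproj : ∀ n, Module.Projective S (C.X n)) (hC : HasParametrix C)
    (hab : ∀ n ∉ Set.Icc a b, Subsingleton (C.X n)) :
    ∃ D : ChainComplex (ModuleCat.{u} S) ℤ, Nonempty (HomotopyEquiv C D) ∧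
      (∀ n, Module.Projective S (D.X n)) ∧ (∀ n, Module.Finite S (D.X n)) ∧
      ∃ a b : ℤ, ∀ n ∉ Set.Icc a b, Subsingleton (D.X n) := by
  -- The lower bound `min a b` covers an empty range $a > b$. Replacing in degrees up to $b$ can
  -- create a nonzero module in degree $b + 1$, but not above.
  obtain ⟨D, ⟨e⟩, hD, hfin, hDa, hDb⟩ := exists_homotopyEquiv_finite_lt (a := min a b) (b := b)
    hproj hC (fun n hn => hab n fun h => by have := h.1; have := h.2; omega)
    (fun n hn => hab n fun h => by have := h.2; omega) (b + 1) (by omega) le_rfl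
  refine ⟨D, ⟨e⟩, hD, fun n => ?_, min a b, b + 1, fun n hn => ?_⟩
  · rcases lt_trichotomy n (b + 1) with h | rfl | h
    · exact hfin n h
    -- In degree $b + 1$ there are no boundaries, so $L + h(D_b)$ is already the whole module.
    · obtain ⟨h, hh⟩ := hC.of_homotopyEquiv e
      obtain ⟨L, hL, hφ⟩ := hh (b + 1)
      have := hfin (b + 1 - 1) (by omega)
      have := hDb (b + 1 + 1) (by omega)
      have hL' : (L ⊔ LinearMap.range (h (b + 1 - 1) (b + 1))).FG := hL.sup Submodule.FG.of_finite
      refine ⟨?_⟩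
      convert hL'
      refine (eq_top_iff.2 fun x _ => ?_).symm
      have hx : x = ((LinearMap.id : D.X (b + 1) →ₗ[S] _) - ((D.d (b + 1 + 1) (b + 1)).hom ∘ₗ h (b + 1) (b + 1 + 1) +
          h (b + 1 - 1) (b + 1) ∘ₗ (D.d (b + 1) (b + 1 - 1)).hom)) x +
          h (b + 1 - 1) (b + 1) ((D.d (b + 1) (b + 1 - 1)).hom x) := by
        simp only [LinearMap.sub_apply, LinearMap.add_apply, LinearMap.comp_apply,
          LinearMap.id_apply]
        rw [Subsingleton.elim (h (b + 1) (b + 1 + 1) x) 0, map_zero]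
        abel
      rw [hx]
      exact Submodule.add_mem_sup (hφ x) ⟨_, rfl⟩
    · have := hDb n h
      infer_instance
  · rw [Set.mem_Icc, not_and_or] at hn
    rcases hn with hn | hn
    · exact hDa n (by omega)
    · exact hDb n (by omega)

end StrictPerfect

/-! ### Null-homotopies of projections modulo finite type -/

section Gluing

variable {S : Type u} [Ring S]

/-- The inverse is the geometric series $\sum w^i$, which is finite on each element. -/
theorem exists_inverse_one_sub {M : Type*} [AddCommGroup M] [Module S M] (w : M →ₗ[S] M)
    (hw : ∀ x, ∃ m : ℕ, (w ^ m) x = 0) :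
    ∃ G : M →ₗ[S] M, (∀ x, G x - w (G x) = x) ∧ ∀ x, G (x - w x) = x := by
  have hinj : Function.Injective (LinearMap.id - w : M →ₗ[S] M) := by
    refine (injective_iff_map_eq_zero _).2 fun x hx => ?_
    have hx : x = w x := sub_eq_zero.1 hx
    obtain ⟨m, hm⟩ := hw x
    have : ∀ m : ℕ, (w ^ m) x = x := fun m => by
      induction m with
      | zero => rfl
      | succ m ih => rw [pow_succ, Module.End.mul_apply, ← hx, ih]
    rw [← this m, hm]
  have hsurj : Function.Surjective (LinearMap.id - w : M →ₗ[S] M) := fun x => by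
    obtain ⟨m, hm⟩ := hw x
    refine ⟨(∑ i ∈ Finset.range m, w ^ i) x, ?_⟩
    have := congr($(mul_neg_geom_sum w m) x)
    rw [LinearMap.sub_apply, hm, sub_zero] at this
    exact this
  let e := LinearEquiv.ofBijective (LinearMap.id - w : M →ₗ[S] M) ⟨hinj, hsurj⟩
  exact ⟨e.symm, e.apply_symm_apply, e.symm_apply_apply⟩

/-- If `v = 1 - (d K + K d)` is locally nilpotent after compression by projections `π` that commute
with `d` and `K` up to maps of finite type, then `π` is null-homotopic up to maps of finite type. -/
theorem exists_homotopy_projection {C : ChainComplex (ModuleCat.{u} S) ℤ}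
    (π v : ∀ n, C.X n →ₗ[S] C.X n) (K : ∀ i j, C.X i →ₗ[S] C.X j)
    (hππ : ∀ n x, π n (π n x) = π n x)
    (hv : ∀ n x, v n x = x - ((C.d (n + 1) n).hom (K n (n + 1) x) +
      K (n - 1) n ((C.d n (n - 1)).hom x)))
    (hd : ∀ i j, IsFiniteType ((C.d i j).hom ∘ₗ π i - π j ∘ₗ (C.d i j).hom))
    (hK : ∀ i j, IsFiniteType (K i j ∘ₗ π i - π j ∘ₗ K i j))
    (hnil : ∀ n x, ∃ m : ℕ, ((π n ∘ₗ v n ∘ₗ π n) ^ m) x = 0) :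
    ∃ h : ∀ i j, C.X i →ₗ[S] C.X j, ∀ n, IsFiniteType (π n -
      ((C.d (n + 1) n).hom ∘ₗ h n (n + 1) + h (n - 1) n ∘ₗ (C.d n (n - 1)).hom)) := by
  choose G hG₁ hG₂ using fun n => exists_inverse_one_sub _ (hnil n)
  have hdv : ∀ n x, (C.d (n + 1) n).hom (v (n + 1) x) = v n ((C.d (n + 1) n).hom x) := by
    intro n x
    have : K (n + 1 - 1) (n + 1) ((C.d (n + 1) (n + 1 - 1)).hom x) =
      K n (n + 1) ((C.d (n + 1) n).hom x) :=
      comp_d_congr (fun i => K i (n + 1)) (add_sub_cancel_right n 1) x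
    rw [hv, hv, this, d_d_apply C (n + 1) n (n - 1)]
    simp [d_d_apply]
  have hvπ : ∀ n, IsFiniteType (v n ∘ₗ π n - π n ∘ₗ v n) := by
    intro n
    convert ((((hK n (n + 1)).comp_left (C.d (n + 1) n).hom).add
      ((hd (n + 1) n).comp_right (K n (n + 1)))).add
      (((hd n (n - 1)).comp_left (K (n - 1) n)).add
      ((hK (n - 1) n).comp_right (C.d n (n - 1)).hom))).neg using 1
    ext x
    simp only [LinearMap.sub_apply, LinearMap.add_apply, LinearMap.comp_apply, LinearMap.neg_apply,
      map_sub, map_add, hv]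
    abel
  have hw : ∀ n, IsFiniteType ((C.d (n + 1) n).hom ∘ₗ (π (n + 1) ∘ₗ v (n + 1) ∘ₗ π (n + 1)) -
      (π n ∘ₗ v n ∘ₗ π n) ∘ₗ (C.d (n + 1) n).hom) := by
    intro n
    convert ((hd (n + 1) n).comp_right (v (n + 1) ∘ₗ π (n + 1))).add
      ((hd (n + 1) n).comp_left (π n ∘ₗ v n)) using 1
    ext x
    simp only [LinearMap.sub_apply, LinearMap.add_apply, LinearMap.comp_apply,
      map_sub, hdv]
    abel
  -- With $w = \pi v \pi$, one has $dG - Gd = G(dw - wd)G$.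
  have hG : ∀ n, IsFiniteType ((C.d (n + 1) n).hom ∘ₗ G (n + 1) - G n ∘ₗ (C.d (n + 1) n).hom) := by
    intro n
    convert ((hw n).comp_right (G (n + 1))).comp_left (G n) using 1
    ext x
    have h₁ := hG₁ (n + 1) x
    have h₂ := hG₂ n ((C.d (n + 1) n).hom (G (n + 1) x))
    simp only [LinearMap.sub_apply, LinearMap.comp_apply, map_sub] at h₁ h₂ ⊢
    have h₃ : G n ((C.d (n + 1) n).hom x) = _ :=
      congr(G n ((C.d (n + 1) n).hom $(h₁.symm)))
    rw [map_sub, map_sub] at h₃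
    rw [h₃]
    conv_lhs => enter [1]; rw [← h₂]
    abel
  -- Modulo finite type, $dG\pi K + G\pi K d \equiv G\pi(dK + Kd) = G\pi(1 - v) \equiv G(1 - \pi v
  -- \pi)\pi = \pi$.
  refine ⟨fun i j => G j ∘ₗ π j ∘ₗ K i j, fun n => ?_⟩
  convert ((((hG n).comp_right (π (n + 1) ∘ₗ K n (n + 1))).add
    (((hd (n + 1) n).comp_right (K n (n + 1))).comp_left (G n))).add
    ((hvπ n).comp_left (G n ∘ₗ π n))).neg using 1
  ext x
  have h₁ : (C.d (n + 1) n).hom (K n (n + 1) x) + K (n - 1) n ((C.d n (n - 1)).hom x) =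
      x - v n x := by
    rw [hv]
    abel
  have h₂ := hG₂ n (π n x)
  have h₃ : G n (π n (K (n - 1) n ((C.d n (n - 1)).hom x))) =
      G n (π n x) - G n (π n (v n x)) - G n (π n ((C.d (n + 1) n).hom (K n (n + 1) x))) := by
    rw [← map_sub, ← map_sub, ← map_sub, ← map_sub, ← h₁]
    congr 2
    abel
  simp only [LinearMap.sub_apply, LinearMap.add_apply, LinearMap.comp_apply, LinearMap.neg_apply,
    map_sub, hππ] at h₂ ⊢
  rw [h₃]
  nth_rw 1 [← h₂]
  abel

end Gluing

/-! ### Degrees, banded maps and the cut at zero -/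

section Degree

variable {S : Type*} [Ring S] {M M' : Type*} [AddCommGroup M] [Module S M] [AddCommGroup M']
  [Module S M'] {ι ι' : Type*} (β : Module.Basis (ℤ × ι) S M) (β' : Module.Basis (ℤ × ι') S M')

/-- The span of the basis vectors whose degree lies in `I`. -/
def degreeSpan (I : Set ℤ) : Submodule S M :=
  Submodule.span S (β '' (Prod.fst ⁻¹' I))

theorem basis_mem_degreeSpan {I : Set ℤ} {p : ℤ × ι} (hp : p.1 ∈ I) : β p ∈ degreeSpan β I :=
  Submodule.subset_span ⟨p, hp, rfl⟩

theorem degreeSpan_mono {I J : Set ℤ} (h : I ⊆ J) : degreeSpan β I ≤ degreeSpan β J :=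
  Submodule.span_mono (Set.image_mono (Set.preimage_mono h))

variable {β} in
theorem map_mem_of_mem_degreeSpan {f : M →ₗ[S] M'} {L : Submodule S M'} {I : Set ℤ}
    (h : ∀ p : ℤ × ι, p.1 ∈ I → f (β p) ∈ L) {x : M} (hx : x ∈ degreeSpan β I) : f x ∈ L := by
  refine (Submodule.span_le (p := L.comap f)).2 ?_ hx
  rintro _ ⟨p, hp, rfl⟩
  exact h p hp

theorem degreeSpan_univ : degreeSpan β Set.univ = ⊤ := by
  rw [degreeSpan, Set.preimage_univ, Set.image_univ, β.span_eq]

theorem degreeSpan_fg [Finite ι] {I : Set ℤ} (hI : I.Finite) : (degreeSpan β I).FG := by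
  refine Submodule.fg_span (Set.Finite.image _ ?_)
  have : Prod.fst ⁻¹' I = I ×ˢ (Set.univ : Set ι) := by ext; simp
  rw [this]
  exact hI.prod Set.finite_univ

theorem exists_mem_degreeSpan (x : M) : ∃ N : ℕ, x ∈ degreeSpan β (Set.Icc (-N : ℤ) N) := by
  have hx : x ∈ degreeSpan β Set.univ := degreeSpan_univ β ▸ Submodule.mem_top
  induction hx using Submodule.span_induction with
  | mem x hx =>
    obtain ⟨p, -, rfl⟩ := hx
    exact ⟨p.1.natAbs, basis_mem_degreeSpan β ⟨by omega, by omega⟩⟩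
  | zero => exact ⟨0, zero_mem _⟩
  | add x y _ _ hx hy =>
    obtain ⟨N, hx⟩ := hx
    obtain ⟨N', hy⟩ := hy
    exact ⟨N + N', add_mem (degreeSpan_mono β (Set.Icc_subset_Icc (by omega) (by omega)) hx)
      (degreeSpan_mono β (Set.Icc_subset_Icc (by omega) (by omega)) hy)⟩
  | smul s x _ hx =>
    obtain ⟨N, hx⟩ := hx
    exact ⟨N, Submodule.smul_mem _ _ hx⟩

open Classical in
/-- The projection onto the span of the basis vectors with degree in `I`. -/
def degreeProj (I : Set ℤ) : M →ₗ[S] M :=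
  β.constr ℕ fun p => if p.1 ∈ I then β p else 0

theorem degreeProj_basis_of_mem {I : Set ℤ} {p : ℤ × ι} (hp : p.1 ∈ I) :
    degreeProj β I (β p) = β p := by
  rw [degreeProj, Module.Basis.constr_basis, if_pos hp]

theorem degreeProj_basis_of_notMem {I : Set ℤ} {p : ℤ × ι} (hp : p.1 ∉ I) :
    degreeProj β I (β p) = 0 := by
  rw [degreeProj, Module.Basis.constr_basis, if_neg hp]

theorem degreeProj_degreeProj (I : Set ℤ) (x : M) :
    degreeProj β I (degreeProj β I x) = degreeProj β I x := by
  refine LinearMap.congr_fun (f := degreeProj β I ∘ₗ degreeProj β I) (β.ext fun p => ?_) x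
  by_cases hp : p.1 ∈ I
  · rw [LinearMap.comp_apply, degreeProj_basis_of_mem β hp, degreeProj_basis_of_mem β hp]
  · rw [LinearMap.comp_apply, degreeProj_basis_of_notMem β hp, map_zero]

theorem degreeProj_add_compl (I : Set ℤ) :
    degreeProj β I + degreeProj β Iᶜ = LinearMap.id := by
  refine β.ext fun p => ?_
  by_cases hp : p.1 ∈ I
  · rw [LinearMap.add_apply, degreeProj_basis_of_mem β hp,
      degreeProj_basis_of_notMem β (Set.notMem_compl_iff.2 hp), add_zero, LinearMap.id_apply]
  · rw [LinearMap.add_apply, degreeProj_basis_of_notMem β hp,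
      degreeProj_basis_of_mem β (Set.mem_compl hp), zero_add, LinearMap.id_apply]

theorem degreeProj_mem {I J : Set ℤ} {x : M} (hx : x ∈ degreeSpan β J) :
    degreeProj β I x ∈ degreeSpan β J := by
  refine map_mem_of_mem_degreeSpan (fun p hp => ?_) hx
  by_cases hp' : p.1 ∈ I
  · rw [degreeProj_basis_of_mem β hp']
    exact basis_mem_degreeSpan β hp
  · rw [degreeProj_basis_of_notMem β hp']
    exact zero_mem _

theorem degreeProj_eq_zero {I J : Set ℤ} (h : Disjoint J I) {x : M} (hx : x ∈ degreeSpan β J) :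
    degreeProj β I x = 0 := by
  have : degreeProj β I x ∈ (⊥ : Submodule S M) := map_mem_of_mem_degreeSpan (fun p hp => by
    rw [degreeProj_basis_of_notMem β (Set.disjoint_left.1 h hp)]
    exact zero_mem _) hx
  exact this

theorem degreeProj_eq_self {I J : Set ℤ} (h : J ⊆ I) {x : M} (hx : x ∈ degreeSpan β J) :
    degreeProj β I x = x := by
  have : (degreeProj β I - LinearMap.id : M →ₗ[S] M) x ∈ (⊥ : Submodule S M) :=
    map_mem_of_mem_degreeSpan (fun p hp => by
      rw [LinearMap.sub_apply, degreeProj_basis_of_mem β (h hp), LinearMap.id_apply, sub_self]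
      exact zero_mem _) hx
  exact sub_eq_zero.1 this

/-- A linear map is banded if it changes degrees by a bounded amount. -/
def IsBanded (f : M →ₗ[S] M') : Prop :=
  ∃ N : ℕ, ∀ p, f (β p) ∈ degreeSpan β' (Set.Icc (p.1 - N) (p.1 + N))

variable {β β'}

theorem IsBanded.isFiniteType_commutator_neg [Finite ι'] {f : M →ₗ[S] M'}
    (hf : IsBanded β β' f) :
    IsFiniteType (f ∘ₗ degreeProj β (Set.Iio 0) - degreeProj β' (Set.Iio 0) ∘ₗ f) := by
  obtain ⟨N, hf⟩ := hf
  -- The commutator vanishes on basis vectors farther than $N$ from the cut; the remaining ones have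
  -- degree in $[-N, N]$, so their images lie in $[-2N, 2N]$.
  refine ⟨_, degreeSpan_fg β' (Set.finite_Icc (-(2 * N) : ℤ) (2 * N)), fun x => ?_⟩
  refine map_mem_of_mem_degreeSpan (β := β) (I := Set.univ) (fun p _ => ?_)
    (degreeSpan_univ β ▸ Submodule.mem_top)
  rw [LinearMap.sub_apply, LinearMap.comp_apply, LinearMap.comp_apply]
  by_cases h : p.1 + N < 0
  · have hp : p.1 ∈ Set.Iio (0 : ℤ) := Set.mem_Iio.2 (by omega)
    rw [degreeProj_basis_of_mem β hp, degreeProj_eq_self β' (fun j hj => ?_) (hf p), sub_self]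
    · exact zero_mem _
    · exact lt_of_le_of_lt hj.2 h
  · by_cases h' : 0 ≤ p.1 - N
    · have hp : p.1 ∉ Set.Iio (0 : ℤ) := fun hp => by have := Set.mem_Iio.1 hp; omega
      rw [degreeProj_basis_of_notMem β hp, degreeProj_eq_zero β' _ (hf p), map_zero, sub_zero]
      · exact zero_mem _
      · exact Set.disjoint_left.2 fun j hj hj' => by
          have := hj.1
          have := Set.mem_Iio.1 hj'
          omega
    · have h₁ : f (β p) ∈ degreeSpan β' (Set.Icc (-(2 * N) : ℤ) (2 * N)) :=
        degreeSpan_mono β' (Set.Icc_subset_Icc (by omega) (by omega)) (hf p)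
      refine sub_mem ?_ (degreeProj_mem β' h₁)
      by_cases hp : p.1 ∈ Set.Iio (0 : ℤ)
      · rwa [degreeProj_basis_of_mem β hp]
      · rw [degreeProj_basis_of_notMem β hp, map_zero]
        exact zero_mem _

theorem IsBanded.isFiniteType_commutator_nonneg [Finite ι'] {f : M →ₗ[S] M'}
    (hf : IsBanded β β' f) :
    IsFiniteType (f ∘ₗ degreeProj β (Set.Iio 0)ᶜ - degreeProj β' (Set.Iio 0)ᶜ ∘ₗ f) := by
  have h := degreeProj_add_compl β (Set.Iio 0)
  have h' := degreeProj_add_compl β' (Set.Iio 0)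
  rw [add_comm, ← eq_sub_iff_add_eq] at h h'
  convert hf.isFiniteType_commutator_neg.neg using 1
  rw [h, h']
  ext x
  simp only [LinearMap.sub_apply, LinearMap.comp_apply, LinearMap.neg_apply, map_sub,
    LinearMap.id_apply]
  abel

/-- Each application of $v$ raises $\varepsilon j$ by at least one, while `I` admits only
$\varepsilon j \le 0$; after finitely many steps the projection kills everything. -/
theorem exists_pow_degreeProj_comp_eq_zero {ε : ℤ} (hε : ε = 1 ∨ ε = -1) {I : Set ℤ}
    (hI : ∀ j ∈ I, ε * j ≤ 0) {v : M →ₗ[S] M}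
    (hv : ∀ p, v (β p) ∈ degreeSpan β {j | ε * p.1 < ε * j}) (x : M) :
    ∃ m : ℕ, ((degreeProj β I ∘ₗ v ∘ₗ degreeProj β I) ^ m) x = 0 := by
  have key : ∀ m : ℕ, ∀ x ∈ degreeSpan β {j | -(m : ℤ) < ε * j},
      ((degreeProj β I ∘ₗ v ∘ₗ degreeProj β I) ^ (m + 1)) x = 0 := by
    intro m
    induction m with
    | zero =>
      intro x hx
      rw [zero_add, pow_one, LinearMap.comp_apply, LinearMap.comp_apply,
        degreeProj_eq_zero β _ hx, map_zero, map_zero]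
      refine Set.disjoint_left.2 fun j hj hj' => ?_
      have h₁ := hI j hj'
      have h₂ : -((0 : ℕ) : ℤ) < ε * j := hj
      omega
    | succ m ih =>
      intro x hx
      rw [pow_succ, Module.End.mul_apply]
      refine ih _ (degreeProj_mem β (map_mem_of_mem_degreeSpan (β := β) (f := v) (fun p hp => ?_)
        (degreeProj_mem β hx)))
      refine degreeSpan_mono β (fun j hj => ?_) (hv p)
      have h₁ : -((m + 1 : ℕ) : ℤ) < ε * p.1 := hp
      have h₂ : ε * p.1 < ε * j := hj
      change -(m : ℤ) < ε * j
      push_cast at h₁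
      omega
  obtain ⟨N, hN⟩ := exists_mem_degreeSpan β x
  refine ⟨N + 1 + 1, key (N + 1) x (degreeSpan_mono β (fun j hj => ?_) hN)⟩
  have h₁ := hj.1
  have h₂ := hj.2
  change -((N + 1 : ℕ) : ℤ) < ε * j
  rcases hε with rfl | rfl <;> push_cast <;> omega

variable {t : ℤ → M →ₗ[S] M} {t' : ℤ → M' →ₗ[S] M'}

theorem shift_mem_degreeSpan (ht : ∀ k j i, t k (β (j, i)) = β (j + k, i)) {I J : Set ℤ} {k : ℤ}
    (hIJ : ∀ j ∈ I, j + k ∈ J) {x : M} (hx : x ∈ degreeSpan β I) : t k x ∈ degreeSpan β J :=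
  map_mem_of_mem_degreeSpan (fun p hp => by
    rw [← Prod.mk.eta (p := p), ht]
    exact basis_mem_degreeSpan β (hIJ _ hp)) hx

/-- Commuting with shifts reduces the bound to the finitely many basis vectors of degree $0$. -/
theorem isBanded_of_comm_shift [Finite ι] (ht : ∀ k j i, t k (β (j, i)) = β (j + k, i))
    (ht' : ∀ k j i, t' k (β' (j, i)) = β' (j + k, i)) {f : M →ₗ[S] M'}
    (hf : ∀ k x, f (t k x) = t' k (f x)) : IsBanded β β' f := by
  have := Fintype.ofFinite ι
  choose N hN using fun i => exists_mem_degreeSpan β' (f (β (0, i)))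
  refine ⟨∑ i, N i, fun ⟨j, i⟩ => ?_⟩
  have h : β (j, i) = t j (β (0, i)) := by rw [ht, zero_add]
  have hle : (N i : ℤ) ≤ ((∑ i, N i : ℕ) : ℤ) :=
    Int.ofNat_le.2 (Finset.single_le_sum (f := N) (fun _ _ => Nat.zero_le _) (Finset.mem_univ i))
  rw [h, hf]
  refine shift_mem_degreeSpan ht' (I := Set.Icc (-N i : ℤ) (N i)) ?_ (hN i)
  refine fun l hl => ⟨?_, ?_⟩
  · have := hl.1
    change j - _ ≤ l + j
    omega
  · have := hl.2
    change l + j ≤ j + _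
    omega

theorem map_basis_mem_of_comm_shift (ht : ∀ k j i, t k (β (j, i)) = β (j + k, i)) {ε : ℤ}
    {v : M →ₗ[S] M} (hcomm : ∀ k x, v (t k x) = t k (v x))
    (hv : ∀ i, v (β (0, i)) ∈ degreeSpan β {j | 0 < ε * j}) (p : ℤ × ι) :
    v (β p) ∈ degreeSpan β {j | ε * p.1 < ε * j} := by
  obtain ⟨j, i⟩ := p
  have h : β (j, i) = t j (β (0, i)) := by rw [ht, zero_add]
  rw [h, hcomm]
  refine shift_mem_degreeSpan ht (fun l hl => ?_) (hv i)
  have : 0 < ε * l := hl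
  change ε * j < ε * (l + j)
  rw [mul_add]
  omega

end Degree

/-! ### Gluing the two halves -/

section Parametrix

variable {S : Type u} [Ring S] {C : ChainComplex (ModuleCat.{u} S) ℤ} {ι : ℤ → Type*}
  [∀ n, Finite (ι n)] (β : ∀ n, Module.Basis (ℤ × ι n) S (C.X n))
  (t : ∀ n, ℤ → C.X n →ₗ[S] C.X n)

/-- A complex with an action of the powers of `T` has a parametrix if the identity is homotopic to a
map that raises degrees, and also to a map that lowers degrees. -/
theorem hasParametrix_of_shift (ht : ∀ n k j i, t n k (β n (j, i)) = β n (j + k, i))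
    (hd : ∀ i j k x, (C.d i j).hom (t i k x) = t j k ((C.d i j).hom x))
    (hK : ∀ ε : ℤ, ε = 1 ∨ ε = -1 → ∃ K : ∀ i j, C.X i →ₗ[S] C.X j,
      (∀ i j k x, K i j (t i k x) = t j k (K i j x)) ∧
      ∀ n i, β n (0, i) - ((C.d (n + 1) n).hom (K n (n + 1) (β n (0, i))) +
        K (n - 1) n ((C.d n (n - 1)).hom (β n (0, i)))) ∈ degreeSpan (β n) {j | 0 < ε * j}) :
    HasParametrix C := by
  have hbd : ∀ i j, IsBanded (β i) (β j) (C.d i j).hom := fun i j =>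
    isBanded_of_comm_shift (ht i) (ht j) (hd i j)
  have half : ∀ (ε : ℤ), ε = 1 ∨ ε = -1 → ∀ I : Set ℤ, (∀ j ∈ I, ε * j ≤ 0) →
      (∀ i j (f : C.X i →ₗ[S] C.X j), IsBanded (β i) (β j) f →
        IsFiniteType (f ∘ₗ degreeProj (β i) I - degreeProj (β j) I ∘ₗ f)) →
      ∃ h : ∀ i j, C.X i →ₗ[S] C.X j, ∀ n, IsFiniteType (degreeProj (β n) I -
        ((C.d (n + 1) n).hom ∘ₗ h n (n + 1) + h (n - 1) n ∘ₗ (C.d n (n - 1)).hom)) := by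
    intro ε hε I hI hcomm
    obtain ⟨K, hKt, hKv⟩ := hK ε hε
    let v : ∀ n, C.X n →ₗ[S] C.X n := fun n => LinearMap.id -
      ((C.d (n + 1) n).hom ∘ₗ K n (n + 1) + K (n - 1) n ∘ₗ (C.d n (n - 1)).hom)
    refine exists_homotopy_projection (fun n => degreeProj (β n) I) v K
      (fun n x => degreeProj_degreeProj (β n) I x) (fun n x => rfl)
      (fun i j => hcomm i j _ (hbd i j))
      (fun i j => hcomm i j _ (isBanded_of_comm_shift (ht i) (ht j) (hKt i j)))
      (fun n x => exists_pow_degreeProj_comp_eq_zero hε hI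
        (map_basis_mem_of_comm_shift (ht n) (fun k x => ?_) (hKv n)) x)
    simp only [v, LinearMap.sub_apply, LinearMap.add_apply, LinearMap.comp_apply,
      LinearMap.id_apply, hKt, hd, map_sub, map_add]
  -- Degree-raising maps are used on the negative half and degree-lowering ones on the nonnegative
  -- half, so that both push towards the cut.
  obtain ⟨h, hh⟩ := half 1 (Or.inl rfl) (Set.Iio 0)
    (fun j hj => by have := Set.mem_Iio.1 hj; omega) fun i j f hf => hf.isFiniteType_commutator_neg
  obtain ⟨h', hh'⟩ := half (-1) (Or.inr rfl) (Set.Iio 0)ᶜ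
    (fun j hj => by have : ¬ j < 0 := hj; omega)
    fun i j f hf => hf.isFiniteType_commutator_nonneg
  refine ⟨fun i j => h i j + h' i j, fun n => ?_⟩
  convert (hh n).add (hh' n) using 1
  rw [← degreeProj_add_compl (β n) (Set.Iio 0), LinearMap.comp_add, LinearMap.add_comp]
  abel

end Parametrix

/-! ### Contracting bounded acyclic complexes of projectives -/

section Contraction

variable {B : Type u} [Ring B]

theorem exists_preimage_of_acyclic {E : ChainComplex (ModuleCat.{u} B) ℤ} (hE : E.Acyclic)
    {i j l : ℤ} (hj : j + 1 = i) (hl : i + 1 = l) (x : E.X i) (hx : (E.d i j).hom x = 0) :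
    ∃ y : E.X l, (E.d l i).hom y = x :=
  (ShortComplex.moduleCat_exact_iff _).1
    ((E.exactAt_iff' l i j ((ComplexShape.down ℤ).prev_eq' hl)
      ((ComplexShape.down ℤ).next_eq' hj)).1 (hE i)) x hx

/-- A bounded acyclic complex of projective modules is contractible. -/
theorem exists_contraction {E : ChainComplex (ModuleCat.{u} B) ℤ} (hE : E.Acyclic)
    (hproj : ∀ n, Module.Projective B (E.X n)) {a b : ℤ}
    (hab : ∀ n ∉ Set.Icc a b, Subsingleton (E.X n)) :
    ∃ H : ∀ i j, E.X i →ₗ[B] E.X j, ∀ i j l, j + 1 = i → i + 1 = l → ∀ x,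
      (E.d l i).hom (H i l x) + H j i ((E.d i j).hom x) = x := by
  have key : ∀ m : ℕ, ∃ H : ∀ i j, E.X i →ₗ[B] E.X j, ∀ i j l, j + 1 = i → i + 1 = l →
      i < a + m → ∀ x, (E.d l i).hom (H i l x) + H j i ((E.d i j).hom x) = x := by
    intro m
    induction m with
    | zero =>
      refine ⟨fun _ _ => 0, fun i j l _ _ hi x => ?_⟩
      have := hab i fun h => by have := h.1; push_cast at hi; omega
      exact Subsingleton.elim _ _
    | succ m ih =>
      obtain ⟨H, hH⟩ := ih
      set k : ℤ := a + m with hk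
      -- By the contraction identity one degree lower, $dHd = d$; so $1 - Hd$ takes values in the
      -- cycles and lifts through $E_{k+1} \to Z_k$, which is onto by acyclicity.
      have hφ : ∀ x : E.X k, (E.d k (k - 1)).hom
          ((LinearMap.id - H (k - 1) k ∘ₗ (E.d k (k - 1)).hom : E.X k →ₗ[B] E.X k) x) = 0 := by
        intro x
        have := hH (k - 1) (k - 1 - 1) k (by omega) (by omega) (by omega)
          ((E.d k (k - 1)).hom x)
        rw [d_d_apply, map_zero, add_zero] at this
        simp only [LinearMap.sub_apply, LinearMap.id_apply, LinearMap.comp_apply, map_sub, this,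
          sub_self]
      let d' : E.X (k + 1) →ₗ[B] LinearMap.ker (E.d k (k - 1)).hom :=
        (E.d (k + 1) k).hom.codRestrict _ fun x => d_d_apply E _ _ _ x
      have hd' : Function.Surjective d' := fun ⟨x, hx⟩ => by
        obtain ⟨y, hy⟩ := exists_preimage_of_acyclic hE (by omega) rfl x hx
        exact ⟨y, Subtype.ext hy⟩
      have := hproj k
      obtain ⟨s, hs⟩ := Module.projective_lifting_property d' (LinearMap.codRestrict _ _ hφ) hd'
      refine ⟨Function.update H k (Function.update (H k) (k + 1) s), fun i j l hj hl hi x => ?_⟩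
      have hjk : j ≠ k := by push_cast at hi; omega
      rw [Function.update_of_ne hjk]
      by_cases hik : i = k
      · subst hl hik
        obtain rfl : j = k - 1 := by omega
        rw [Function.update_self, Function.update_self]
        have hsx : (E.d (k + 1) k).hom (s x) = x - H (k - 1) k ((E.d k (k - 1)).hom x) :=
          congr(($hs x).1)
        rw [hsx, sub_add_cancel]
      · rw [Function.update_of_ne hik]
        exact hH i j l hj hl (by push_cast at hi; omega) x
  obtain ⟨H, hH⟩ := key (b + 1 - a).toNat
  refine ⟨H, fun i j l hj hl x => ?_⟩
  by_cases hi : i < a + (b + 1 - a).toNat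
  · exact hH i j l hj hl hi x
  · have := hab i fun h => by have := h.2; omega
    exact Subsingleton.elim _ _

end Contraction

/-! ### Bases under extension of scalars -/

section TensorBasis

variable {A B : Type u} [Ring A] [Ring B] (g : A →+* B) {V : Type u} [AddCommGroup V] [Module A V]

theorem BalancedTensor.tmul_smul (c : B) (a : A) (x : V) :
    BalancedTensor.tmul g c (a • x) = BalancedTensor.tmul g (c * g a) x :=
  Eq.symm <| (Submodule.Quotient.eq (balancing g V)).2 (Submodule.subset_span ⟨c, a, x, rfl⟩)

theorem BalancedTensor.smul_tmul (c c' : B) (x : V) :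
    c • BalancedTensor.tmul g c' x = BalancedTensor.tmul g (c * c') x := rfl

/-- The additive map `x ↦ c ⊗ x`. -/
def BalancedTensor.tmulHom (c : B) : V →+ BalancedTensor g V where
  toFun := BalancedTensor.tmul g c
  map_zero' := by simp [BalancedTensor.tmul]
  map_add' x y := by simp only [BalancedTensor.tmul, TensorProduct.tmul_add,
    Submodule.Quotient.mk_add]

variable {ι : Type*} [Fintype ι] (b : Module.Basis ι A V)

/-- The coordinates of an element of `B ⊗_A V` with respect to a basis of `V`. -/
def BalancedTensor.coord : BalancedTensor g V →ₗ[B] ι → B :=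
  Submodule.liftQ _ (TensorProduct.AlgebraTensorModule.lift
    (LinearMap.mk₂' B ℤ (fun (c : B) (x : V) (i : ι) => c * g (b.repr x i))
      (fun c c' x => by ext i; simp [add_mul]) (fun c c' x => by ext i; simp [mul_assoc])
      (fun c x y => by ext i; simp [mul_add]) (fun n c x => by ext i; simp [← mul_assoc, (Int.cast_commute n c).eq]))) <| by
    refine Submodule.span_le.2 ?_
    rintro _ ⟨c, a, x, rfl⟩
    change _ = _
    rw [map_sub, TensorProduct.AlgebraTensorModule.lift_tmul,
      TensorProduct.AlgebraTensorModule.lift_tmul]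
    ext i
    simp [mul_assoc]

omit [Fintype ι] in
theorem BalancedTensor.coord_tmul (c : B) (x : V) (i : ι) :
    BalancedTensor.coord g b (BalancedTensor.tmul g c x) i = c * g (b.repr x i) := rfl

/-- The basis of `B ⊗_A V` induced by a basis of `V`. -/
def BalancedTensor.basis : Module.Basis ι B (BalancedTensor g V) :=
  Module.Basis.ofEquivFun <| LinearEquiv.ofLinearMap (BalancedTensor.coord g b)
    (Fintype.linearCombination B fun i => BalancedTensor.tmul g 1 (b i))
    (by
      classical
      refine LinearMap.pi_ext' fun i => LinearMap.ext_ring ?_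
      ext j
      by_cases h : i = j
      · subst h
        simp [Fintype.linearCombination_apply_single, BalancedTensor.coord_tmul]
      · simp [Fintype.linearCombination_apply_single, BalancedTensor.coord_tmul, h])
    (by
      refine BalancedTensor.hom_ext g fun c x => ?_
      rw [LinearMap.comp_apply, Fintype.linearCombination_apply, LinearMap.id_apply]
      simp only [BalancedTensor.coord_tmul, BalancedTensor.smul_tmul, mul_one]
      simp only [← BalancedTensor.tmul_smul]
      change ∑ i, BalancedTensor.tmulHom g c _ = BalancedTensor.tmulHom g c x
      rw [← map_sum, b.sum_repr])

theorem BalancedTensor.basis_repr_tmul (c : B) (x : V) (i : ι) :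
    (BalancedTensor.basis g b).repr (BalancedTensor.tmul g c x) i = c * g (b.repr x i) := rfl

end TensorBasis

/-! ### Order of Laurent series and truncation -/

section Order

open MulOpposite

variable {R : Type u} [Ring R] {ι ι' : Type*} {E E' : Type*} [AddCommGroup E] [Module R⸨X⸩ᵐᵒᵖ E]
  [AddCommGroup E'] [Module R⸨X⸩ᵐᵒᵖ E'] (e : Module.Basis ι R⸨X⸩ᵐᵒᵖ E)
  (e' : Module.Basis ι' R⸨X⸩ᵐᵒᵖ E')

/-- The elements all of whose coordinates have order at least `m`. -/
def orderGE (m : ℤ) : AddSubgroup E where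
  carrier := {x | ∀ i, (m : WithTop ℤ) ≤ (unop (e.repr x i)).orderTop}
  zero_mem' i := by simp
  add_mem' {x y} hx hy i := by
    rw [map_add, Finsupp.add_apply, MulOpposite.unop_add]
    exact (le_min (hx i) (hy i)).trans HahnSeries.min_orderTop_le_orderTop_add
  neg_mem' {x} hx i := by
    rw [map_neg, Finsupp.neg_apply, MulOpposite.unop_neg, HahnSeries.orderTop_neg]
    exact hx i

variable {e e'}

theorem orderGE_mono {m n : ℤ} (h : m ≤ n) {x : E} (hx : x ∈ orderGE e n) : x ∈ orderGE e m :=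
  fun i => (WithTop.coe_le_coe.2 h).trans (hx i)

theorem basis_mem_orderGE (i : ι) : e i ∈ orderGE e 0 := fun j => by
  rw [e.repr_self]
  by_cases h : i = j
  · subst h
    rw [Finsupp.single_eq_same, MulOpposite.unop_one]
    exact HahnSeries.orderTop_single_le
  · rw [Finsupp.single_eq_of_ne (Ne.symm h)]
    simp

theorem smul_mem_orderGE {m n : ℤ} {c : R⸨X⸩ᵐᵒᵖ} (hc : (m : WithTop ℤ) ≤ (unop c).orderTop) {x : E}
    (hx : x ∈ orderGE e n) : c • x ∈ orderGE e (m + n) := fun i => by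
  rw [map_smul, Finsupp.smul_apply, smul_eq_mul, MulOpposite.unop_mul, add_comm, WithTop.coe_add]
  exact (add_le_add (hx i) hc).trans HahnSeries.orderTop_add_le_mul

theorem exists_le_orderTop (s : R⸨X⸩) : ∃ m : ℤ, (m : WithTop ℤ) ≤ s.orderTop := by
  by_cases h : s = 0
  · exact ⟨0, by simp [h]⟩
  · exact ⟨s.order, (HahnSeries.order_eq_orderTop_of_ne_zero h).le⟩

theorem exists_mem_orderGE [Finite ι] (x : E) : ∃ m, x ∈ orderGE e m := by
  choose m hm using fun i => exists_le_orderTop (unop (e.repr x i))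
  obtain ⟨M, hM⟩ := Set.Finite.bddBelow (Set.finite_range m)
  exact ⟨M, fun i => (WithTop.coe_le_coe.2 (hM ⟨i, rfl⟩)).trans (hm i)⟩

/-- The finitely many matrix entries of $f$ have a common lower bound for their orders, and orders
at least add under multiplication. -/
theorem exists_map_mem_orderGE [Finite ι] [Finite ι'] (f : E →ₗ[R⸨X⸩ᵐᵒᵖ] E') :
    ∃ N : ℤ, ∀ m, ∀ x ∈ orderGE e m, f x ∈ orderGE e' (m - N) := by
  have := Fintype.ofFinite ι
  choose m hm using fun i => exists_mem_orderGE (e := e') (f (e i))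
  obtain ⟨M, hM⟩ := Set.Finite.bddBelow (Set.finite_range m)
  refine ⟨-M, fun n x hx => ?_⟩
  rw [← e.sum_repr x, map_sum]
  refine sum_mem fun i _ => ?_
  rw [map_smul, sub_neg_eq_add]
  exact smul_mem_orderGE (hx i) (orderGE_mono (hM ⟨i, rfl⟩) (hm i))

theorem toSeries_coeff {ε : ℤ} (hε : ε = 1 ∨ ε = -1) (p : R[T;T⁻¹]) (j : ℤ) :
    (toSeries R ε p).coeff (ε * j) = p.coeff j := by
  induction p using LaurentPolynomial.induction_on' with
  | add p q hp hq => rw [map_add, HahnSeries.coeff_add, hp, hq]; rfl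
  | C_mul_T n a =>
    rw [map_mul, toSeries_C, toSeries_T, ← LaurentPolynomial.single_eq_C_mul_T,
      HahnSeries.C_apply, HahnSeries.single_mul_single, mul_one, zero_add]
    by_cases h : j = n
    · subst h
      rw [HahnSeries.coeff_single_same, AddMonoidAlgebra.coeff_single, Finsupp.single_eq_same]
    · have h' : ε * j ≠ ε * n := by rcases hε with rfl | rfl <;> omega
      rw [HahnSeries.coeff_single_of_ne h', AddMonoidAlgebra.coeff_single,
        Finsupp.single_eq_of_ne h]

theorem exists_truncation {ε : ℤ} (hε : ε = 1 ∨ ε = -1) (s : R⸨X⸩) (M : ℤ) :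
    ∃ p : R[T;T⁻¹], (M : WithTop ℤ) ≤ (s - toSeries R ε p).orderTop := by
  obtain ⟨L, hL⟩ := exists_le_orderTop s
  -- The terms of $s$ below order $M$, finitely many as none occurs below $L$; the power $y^k$ is
  -- the image of $x^{\varepsilon k}$.
  refine ⟨∑ k ∈ Finset.Ico L M, AddMonoidAlgebra.single (ε * k) (s.coeff k), ?_⟩
  refine HahnSeries.le_orderTop_iff_forall.2 fun j hj => ?_
  have hεε : ε * ε = 1 := by rcases hε with rfl | rfl <;> rfl
  have hj' : j = ε * (ε * j) := by rw [← mul_assoc, hεε, one_mul]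
  have hinj : ∀ k, ε * k = ε * j ↔ k = j := fun k => by rcases hε with rfl | rfl <;> omega
  rw [HahnSeries.coeff_sub, hj', toSeries_coeff hε, ← hj', sub_eq_zero]
  have : (∑ k ∈ Finset.Ico L M, AddMonoidAlgebra.single (ε * k) (s.coeff k)).coeff (ε * j) =
      ∑ k ∈ Finset.Ico L M, if k = j then s.coeff k else 0 := by
    rw [AddMonoidAlgebra.coeff_sum, Finsupp.finsetSum_apply]
    refine Finset.sum_congr rfl fun k _ => ?_
    rw [AddMonoidAlgebra.coeff_single, Finsupp.single_apply]
    simp only [hinj]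
  rw [this, Finset.sum_ite_eq']
  split_ifs with h
  · rfl
  · refine HahnSeries.coeff_eq_zero_of_lt_orderTop (lt_of_lt_of_le (WithTop.coe_lt_coe.2 ?_) hL)
    have := WithTop.coe_lt_coe.1 hj
    rw [Finset.mem_Ico] at h
    omega

end Order

/-! ### Approximating maps over Laurent series by maps over Laurent polynomials -/

section Approximation

open MulOpposite

variable {R : Type u} [Ring R] {ε : ℤ} {V V' : Type u} [AddCommGroup V] [Module R[T;T⁻¹]ᵐᵒᵖ V]
  [AddCommGroup V'] [Module R[T;T⁻¹]ᵐᵒᵖ V'] {ι ι' : Type*} [Fintype ι] [Fintype ι']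
  (b : Module.Basis ι R[T;T⁻¹]ᵐᵒᵖ V) (b' : Module.Basis ι' R[T;T⁻¹]ᵐᵒᵖ V')

/-- The basis of `V ⊗_{R[x,x⁻¹]} R((y))` induced by a basis of `V`. -/
abbrev seriesBasis (ε : ℤ) :
    Module.Basis ι R⸨X⸩ᵐᵒᵖ (BalancedTensor (RingHom.op (toSeries R ε)) V) :=
  BalancedTensor.basis (RingHom.op (toSeries R ε)) b

/-- The canonical map `V → V ⊗_{R[x,x⁻¹]} R((y))`. -/
abbrev toSeriesModule (ε : ℤ) : V →+ BalancedTensor (RingHom.op (toSeries R ε)) V :=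
  BalancedTensor.tmulHom (RingHom.op (toSeries R ε)) 1

theorem toSeriesModule_smul (a : R[T;T⁻¹]ᵐᵒᵖ) (x : V) :
    (toSeriesModule ε (a • x) : BalancedTensor (RingHom.op (toSeries R ε)) V) =
      RingHom.op (toSeries R ε) a • toSeriesModule ε x := by
  refine (BalancedTensor.tmul_smul _ 1 a x).trans ?_
  refine Eq.trans ?_ (BalancedTensor.smul_tmul _ _ 1 x).symm
  rw [one_mul, mul_one]

theorem seriesBasis_repr (x : V) (i : ι) :
    (seriesBasis b ε).repr (toSeriesModule ε x) i = RingHom.op (toSeries R ε) (b.repr x i) :=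
  (BalancedTensor.basis_repr_tmul _ b 1 x i).trans (one_mul _)

theorem seriesBasis_apply (i : ι) : seriesBasis b ε i = toSeriesModule ε (b i) := by
  refine (seriesBasis b ε).repr.injective (Finsupp.ext fun j => ?_)
  rw [seriesBasis_repr, Module.Basis.repr_self, Module.Basis.repr_self]
  by_cases h : i = j
  · subst h
    rw [Finsupp.single_eq_same, Finsupp.single_eq_same, map_one]
  · rw [Finsupp.single_eq_of_ne (Ne.symm h), Finsupp.single_eq_of_ne (Ne.symm h), map_zero]

theorem exists_approximation (hε : ε = 1 ∨ ε = -1)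
    (y : BalancedTensor (RingHom.op (toSeries R ε)) V) (M : ℤ) :
    ∃ x : V, toSeriesModule ε x - y ∈ orderGE (seriesBasis b ε) M := by
  choose p hp using fun i => exists_truncation hε (unop ((seriesBasis b ε).repr y i)) M
  refine ⟨∑ i, op (p i) • b i, fun i => ?_⟩
  rw [map_sub, Finsupp.sub_apply, seriesBasis_repr, b.repr_sum_self, MulOpposite.unop_sub,
    ← HahnSeries.orderTop_neg, neg_sub]
  exact hp i

variable {b b'}

/-- An error estimate on basis vectors extends to all of $V$ because $K$ and $H$ are both linear
over Laurent polynomials. -/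
theorem approximation_mem_orderGE
    {H : BalancedTensor (RingHom.op (toSeries R ε)) V →ₗ[R⸨X⸩ᵐᵒᵖ]
      BalancedTensor (RingHom.op (toSeries R ε)) V'}
    {K : V →ₗ[R[T;T⁻¹]ᵐᵒᵖ] V'} {M : ℤ}
    (hK : ∀ i, toSeriesModule ε (K (b i)) - H (toSeriesModule ε (b i)) ∈
      orderGE (seriesBasis b' ε) M) {m : ℤ} {y : V}
    (hy : toSeriesModule ε y ∈ orderGE (seriesBasis b ε) m) :
    toSeriesModule ε (K y) - H (toSeriesModule ε y) ∈ orderGE (seriesBasis b' ε) (m + M) := by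
  have : toSeriesModule ε (K y) - H (toSeriesModule ε y) =
      ∑ i, RingHom.op (toSeries R ε) (b.repr y i) •
        (toSeriesModule ε (K (b i)) - H (toSeriesModule ε (b i))) := by
    conv_lhs => rw [← b.sum_repr y]
    simp only [map_sum, map_smul, toSeriesModule_smul, smul_sub, Finset.sum_sub_distrib]
  rw [this]
  refine sum_mem fun i _ => smul_mem_orderGE ?_ (hK i)
  have := hy i
  rwa [seriesBasis_repr] at this

end Approximation

section ApproximateContraction

variable {R : Type u} [Ring R]

/-- The complex `C ⊗_{R[x,x⁻¹]} R((y))`, where `y = x ^ ε`. -/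
abbrev novikov (ε : ℤ) (C : Complexes R[T;T⁻¹]) : Complexes R⸨X⸩ :=
  ((tensorRight (toSeries R ε)).mapHomologicalComplex (ComplexShape.down ℤ)).obj C

theorem exists_novikov_contraction {C : Complexes R[T;T⁻¹]} {a c : ℤ}
    (hac : ∀ n ∉ Set.Icc a c, Subsingleton (C.X n)) {ι : ℤ → Type*} [∀ n, Fintype (ι n)]
    (b : ∀ n, Module.Basis (ι n) R[T;T⁻¹]ᵐᵒᵖ (C.X n)) {ε : ℤ} (hC : (novikov ε C).Acyclic) :
    ∃ H : ∀ i j, BalancedTensor (RingHom.op (toSeries R ε)) (C.X i) →ₗ[R⸨X⸩ᵐᵒᵖ]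
        BalancedTensor (RingHom.op (toSeries R ε)) (C.X j), ∀ n y,
      BalancedTensor.map (RingHom.op (toSeries R ε)) (C.d (n + 1) n).hom (H n (n + 1) y) +
        H (n - 1) n (BalancedTensor.map (RingHom.op (toSeries R ε)) (C.d n (n - 1)).hom y) = y := by
  obtain ⟨H, hH⟩ := exists_contraction hC
    (fun n => Module.Projective.of_basis (seriesBasis (b n) ε)) (a := a) (b := c) fun n hn => by
      have := hac n hn
      have : ∀ y : BalancedTensor (RingHom.op (toSeries R ε)) (C.X n), y = 0 := fun y => by
        rw [← (seriesBasis (b n) ε).sum_repr y]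
        refine Finset.sum_eq_zero fun i _ => ?_
        rw [seriesBasis_apply, Subsingleton.elim (b n i) 0, map_zero, smul_zero]
      exact ⟨fun y z => (this y).trans (this z).symm⟩
  exact ⟨H, fun n y => hH n (n - 1) (n + 1) (by omega) rfl y⟩

/-- If `C ⊗ R((y))` is acyclic, then the identity of `C` is homotopic over `R[x,x⁻¹]` to a map whose
matrix entries are divisible by `y = x ^ ε` in `R[[y]]`. -/
theorem exists_approximate_contraction {C : Complexes R[T;T⁻¹]} {a c : ℤ}
    (hac : ∀ n ∉ Set.Icc a c, Subsingleton (C.X n)) {ι : ℤ → Type*} [∀ n, Fintype (ι n)]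
    (b : ∀ n, Module.Basis (ι n) R[T;T⁻¹]ᵐᵒᵖ (C.X n)) {ε : ℤ} (hε : ε = 1 ∨ ε = -1)
    (hC : (novikov ε C).Acyclic) :
    ∃ K : ∀ i j, C.X i →ₗ[R[T;T⁻¹]ᵐᵒᵖ] C.X j, ∀ n i, toSeriesModule ε
      (b n i - ((C.d (n + 1) n).hom (K n (n + 1) (b n i)) +
        K (n - 1) n ((C.d n (n - 1)).hom (b n i)))) ∈ orderGE (seriesBasis (b n) ε) 1 := by
  obtain ⟨H, hH⟩ := exists_novikov_contraction hac b hC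
  let δ := fun i j => BalancedTensor.map (RingHom.op (toSeries R ε)) (C.d i j).hom
  have hδ : ∀ i j x, δ i j (toSeriesModule ε x) = toSeriesModule ε ((C.d i j).hom x) :=
    fun i j x => BalancedTensor.map_tmul _ _ 1 x
  replace hH : ∀ n y, δ (n + 1) n (H n (n + 1) y) + H (n - 1) n (δ n (n - 1) y) = y := hH
  choose N hN using fun i j => exists_map_mem_orderGE (e := seriesBasis (b i) ε)
    (e' := seriesBasis (b j) ε) (δ i j)
  -- The precision compensates for the order `N j i` that the map `δ j i` can lose, and leaves a
  -- surplus of one.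
  choose w hw using fun i j l => exists_approximation (b j) hε
    (H i j (toSeriesModule ε (b i l))) (N j i + 1)
  let K : ∀ i j, C.X i →ₗ[R[T;T⁻¹]ᵐᵒᵖ] C.X j := fun i j => (b i).constr ℕ (w i j)
  have hK : ∀ i j l, toSeriesModule ε (K i j (b i l)) - H i j (toSeriesModule ε (b i l)) ∈
      orderGE (seriesBasis (b j) ε) (N j i + 1) := fun i j l => by
    have : K i j (b i l) = w i j l := (b i).constr_basis ℕ _ l
    rw [this]
    exact hw i j l
  clear_value δ K
  refine ⟨K, fun n i => ?_⟩
  have h₀ : toSeriesModule ε (b n i) ∈ orderGE (seriesBasis (b n) ε) 0 := by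
    rw [← seriesBasis_apply]
    exact basis_mem_orderGE i
  have h₁ := hN (n + 1) n _ _ (hK n (n + 1) i)
  have h₂ := hN n (n - 1) _ _ h₀
  rw [hδ] at h₂
  have h₂ := approximation_mem_orderGE (hK (n - 1) n) h₂
  have h₃ := hH n (toSeriesModule ε (b n i))
  -- Since $dH + Hd = 1$, the error $1 - (dK + Kd)$ equals $-(d(K - H) + (K - H)d)$.
  have h₄ : toSeriesModule ε (b n i - ((C.d (n + 1) n).hom (K n (n + 1) (b n i)) +
      K (n - 1) n ((C.d n (n - 1)).hom (b n i)))) =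
      -(δ (n + 1) n (toSeriesModule ε (K n (n + 1) (b n i)) -
        H n (n + 1) (toSeriesModule ε (b n i))) +
        (toSeriesModule ε (K (n - 1) n ((C.d n (n - 1)).hom (b n i))) -
        H (n - 1) n (toSeriesModule ε ((C.d n (n - 1)).hom (b n i))))) := by
    rw [map_sub, map_add]
    conv_lhs => enter [1]; rw [← h₃]
    rw [map_sub, hδ, hδ]
    abel
  rw [h₄]
  refine neg_mem (add_mem (orderGE_mono ?_ h₁) (orderGE_mono ?_ h₂)) <;> omega

end ApproximateContraction

/-! ### Free modules over Laurent polynomials as graded free modules over the coefficients -/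

section LaurentBasis

open MulOpposite

variable {R : Type u} [Ring R]

/-- The basis of the right `R`-module `R[x,x⁻¹]` that consists of the powers of `x`. -/
def powerBasis : Module.Basis ℤ Rᵐᵒᵖ R[T;T⁻¹]ᵐᵒᵖ :=
  Module.Basis.ofRepr
    { toFun := fun p => (unop p).coeff.mapRange op rfl
      map_add' := fun p q => by ext j; rfl
      map_smul' := fun r p => by ext j; rfl
      invFun := fun f => op (AddMonoidAlgebra.ofCoeff (f.mapRange unop rfl))
      left_inv := fun p => by
        refine unop_injective (LaurentPolynomial.ext fun j => ?_)
        rfl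
      right_inv := fun f => by ext j; rfl }

theorem powerBasis_apply (j : ℤ) :
    (powerBasis j : R[T;T⁻¹]ᵐᵒᵖ) = op (LaurentPolynomial.T j) := by
  refine unop_injective (LaurentPolynomial.ext fun k => ?_)
  change unop (Finsupp.single j (1 : Rᵐᵒᵖ) k) = Finsupp.single j (1 : R) k
  by_cases h : k = j
  · subst h
    rw [Finsupp.single_eq_same, Finsupp.single_eq_same, MulOpposite.unop_one]
  · rw [Finsupp.single_eq_of_ne h, Finsupp.single_eq_of_ne h, MulOpposite.unop_zero]

theorem op_smul_eq_mul (r : Rᵐᵒᵖ) (a : R[T;T⁻¹]ᵐᵒᵖ) :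
    r • a = RingHom.op LaurentPolynomial.C r * a := by
  refine unop_injective (LaurentPolynomial.ext fun k => ?_)
  change (unop a).coeff k * unop r = (unop a * LaurentPolynomial.C (unop r)).coeff k
  rw [← LaurentPolynomial.single_eq_C, AddMonoidAlgebra.coeff_mul_single_zero]

variable {V : Type u} [AddCommGroup V] [Module R[T;T⁻¹]ᵐᵒᵖ V] [Module Rᵐᵒᵖ V]
  (hV : ∀ (r : Rᵐᵒᵖ) (x : V), r • x = (RingHom.op LaurentPolynomial.C r : R[T;T⁻¹]ᵐᵒᵖ) • x)
  {ι : Type*} (b : Module.Basis ι R[T;T⁻¹]ᵐᵒᵖ V)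

include hV in
theorem isScalarTower_laurent : IsScalarTower Rᵐᵒᵖ R[T;T⁻¹]ᵐᵒᵖ V :=
  ⟨fun r a x => by rw [op_smul_eq_mul, mul_smul, hV]⟩

/-- The basis over `R` of a free module over `R[x,x⁻¹]`. -/
def laurentBasis : Module.Basis (ℤ × ι) Rᵐᵒᵖ V :=
  letI := isScalarTower_laurent hV
  powerBasis.smulTower b

theorem laurentBasis_apply (j : ℤ) (i : ι) :
    laurentBasis hV b (j, i) = (op (LaurentPolynomial.T j) : R[T;T⁻¹]ᵐᵒᵖ) • b i := by
  have := isScalarTower_laurent hV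
  rw [laurentBasis, Module.Basis.smulTower_apply, powerBasis_apply]

theorem laurentBasis_repr (x : V) (j : ℤ) (i : ι) :
    (laurentBasis hV b).repr x (j, i) = op ((unop (b.repr x i)).coeff j) := by
  have := isScalarTower_laurent hV
  rw [laurentBasis, Module.Basis.smulTower_repr_mk]
  rfl

/-- Translates order in $y = x^{\varepsilon}$ into degree in $x$: the coefficient of $x^j$ is that
of $y^{\varepsilon j}$, hence zero unless $\varepsilon j \ge 1$. -/
theorem mem_degreeSpan_of_mem_orderGE [Fintype ι] {ε : ℤ} (hε : ε = 1 ∨ ε = -1) {x : V}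
    (hx : toSeriesModule ε x ∈ orderGE (seriesBasis b ε) 1) :
    x ∈ degreeSpan (laurentBasis hV b) {j | 0 < ε * j} := by
  rw [degreeSpan, Module.Basis.mem_span_image]
  rintro ⟨j, i⟩ hj
  have hj : (laurentBasis hV b).repr x (j, i) ≠ 0 := Finsupp.mem_support_iff.1 hj
  by_contra hj'
  have hj' : ¬ 0 < ε * j := hj'
  refine hj ?_
  have h : ((1 : ℤ) : WithTop ℤ) ≤ (toSeries R ε (unop (b.repr x i))).orderTop := by
    have := hx i
    rwa [seriesBasis_repr] at this
  rw [laurentBasis_repr, ← toSeries_coeff hε,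
    HahnSeries.coeff_eq_zero_of_lt_orderTop (lt_of_lt_of_le (WithTop.coe_lt_coe.2 _) h), op_zero]
  omega

/-- Multiplication by a power of `x` as an `R`-linear map. -/
def shift (k : ℤ) : V →ₗ[Rᵐᵒᵖ] V where
  toFun x := (op (LaurentPolynomial.T k) : R[T;T⁻¹]ᵐᵒᵖ) • x
  map_add' x y := smul_add _ x y
  map_smul' r x := by
    rw [hV, hV, RingHom.id_apply, ← mul_smul, ← mul_smul]
    congr 1
    exact congr(op $((LaurentPolynomial.T_mul k (LaurentPolynomial.C (unop r))).symm))

theorem shift_laurentBasis (k j : ℤ) (i : ι) :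
    shift hV k (laurentBasis hV b (j, i)) = laurentBasis hV b (j + k, i) := by
  change (op (LaurentPolynomial.T k) : R[T;T⁻¹]ᵐᵒᵖ) • laurentBasis hV b (j, i) = _
  rw [laurentBasis_apply, laurentBasis_apply, ← mul_smul, ← op_mul, ← LaurentPolynomial.T_add]

/-- Restriction of scalars of a linear map from `R[x,x⁻¹]` to `R`. -/
def restrictLaurent {V' : Type u} [AddCommGroup V'] [Module R[T;T⁻¹]ᵐᵒᵖ V'] [Module Rᵐᵒᵖ V']
    (hV' : ∀ (r : Rᵐᵒᵖ) (x : V'), r • x = (RingHom.op LaurentPolynomial.C r : R[T;T⁻¹]ᵐᵒᵖ) • x)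
    (f : V →ₗ[R[T;T⁻¹]ᵐᵒᵖ] V') : V →ₗ[Rᵐᵒᵖ] V' where
  toFun := f
  map_add' := f.map_add
  map_smul' r x := by rw [hV, hV', map_smul]; rfl

end LaurentBasis

/-! ### The parametrix of the push-forward -/

section Pushforward

variable {R : Type u} [Ring R] (C : Complexes R[T;T⁻¹])

instance (n : ℤ) : Module R[T;T⁻¹]ᵐᵒᵖ ((pushforward C).X n) :=
  inferInstanceAs (Module R[T;T⁻¹]ᵐᵒᵖ (C.X n))

theorem pushforward_smul (n : ℤ) (r : Rᵐᵒᵖ) (x : (pushforward C).X n) :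
    r • x = (RingHom.op LaurentPolynomial.C r : R[T;T⁻¹]ᵐᵒᵖ) • x := rfl

variable {C}

theorem hasParametrix_pushforward {a c : ℤ} (hac : ∀ n ∉ Set.Icc a c, Subsingleton (C.X n))
    {ι : ℤ → Type*} [∀ n, Fintype (ι n)] (b : ∀ n, Module.Basis (ι n) R[T;T⁻¹]ᵐᵒᵖ (C.X n))
    (hC : ∀ ε : ℤ, ε = 1 ∨ ε = -1 → (novikov ε C).Acyclic) : HasParametrix (pushforward C) := by
  let b' : ∀ n, Module.Basis (ι n) R[T;T⁻¹]ᵐᵒᵖ ((pushforward C).X n) := b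
  refine hasParametrix_of_shift (fun n => laurentBasis (pushforward_smul C n) (b' n))
    (fun n => shift (pushforward_smul C n))
    (fun n k j i => shift_laurentBasis (pushforward_smul C n) (b' n) k j i)
    (fun i j k x => (C.d i j).hom.map_smul _ x) fun ε hε => ?_
  obtain ⟨K, hK⟩ := exists_approximate_contraction hac b hε (hC ε hε)
  refine ⟨fun i j => restrictLaurent (V := (pushforward C).X i) (V' := (pushforward C).X j)
    (pushforward_smul C i) (pushforward_smul C j) (K i j),
    fun i j k x => (K i j).map_smul _ x, fun n i => ?_⟩
  have h : laurentBasis (pushforward_smul C n) (b' n) (0, i) = b' n i := by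
    rw [laurentBasis_apply, LaurentPolynomial.T_zero, MulOpposite.op_one, one_smul]
  rw [h]
  exact mem_degreeSpan_of_mem_orderGE (pushforward_smul C n) (b' n) hε (hK n i)

end Pushforward

end Novikov

end

/-- A bounded complex of finitely generated free `R[x,x⁻¹]`-modules with trivial Novikov homology in
both directions is `R`-perfect and `R`-finitely dominated. -/
theorem mainTheorem1 {R : Type u} [Ring R] (C : Novikov.Complexes R[T;T⁻¹])
    (hbounded : Novikov.IsBounded C) (hfree : Novikov.IsFinitelyGeneratedFree C)
    (hzero : (Novikov.novikovZero C).Acyclic) (hinfinity : (Novikov.novikovInfinity C).Acyclic) :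
    Novikov.IsPerfect (Novikov.pushforward C) ∧
      Novikov.IsFinitelyDominated (Novikov.pushforward C) := by
  obtain ⟨a, c, hac⟩ := hbounded
  have hac' : ∀ n ∉ Set.Icc a c, Subsingleton (C.X n) := fun n hn =>
    ModuleCat.subsingleton_of_isZero (hac n hn)
  have hfin := fun n => (hfree n).1
  have hfr := fun n => (hfree n).2
  let b := fun n => Module.Free.chooseBasis R[T;T⁻¹]ᵐᵒᵖ (C.X n)
  have hpar : Novikov.HasParametrix (Novikov.pushforward C) :=
    Novikov.hasParametrix_pushforward hac' b fun ε hε => by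
      -- By definition the two Novikov complexes are the cases $\varepsilon = 1$ and $\varepsilon =
      -- -1$ of `novikov`.
      rcases hε with rfl | rfl
      · exact hzero
      · exact hinfinity
  have hproj : ∀ n, Module.Projective Rᵐᵒᵖ ((Novikov.pushforward C).X n) := fun n =>
    Module.Projective.of_basis (Novikov.laurentBasis (V := (Novikov.pushforward C).X n)
      (Novikov.pushforward_smul C n) (b n))
  obtain ⟨D, ⟨e⟩, hD, hDfin, a', c', hac''⟩ := hpar.exists_homotopyEquiv hproj hac'
  have hperf : Novikov.IsStrictPerfect D :=
    ⟨⟨a', c', fun n hn => by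
      have := hac'' n hn
      exact ModuleCat.isZero_of_subsingleton _⟩, fun n => ⟨hDfin n, hD n⟩⟩
  exact ⟨⟨D, hperf, Relation.EqvGen.rel _ _ ⟨e.hom, inferInstance⟩⟩, ⟨D, hperf, ⟨e⟩⟩⟩
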